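/- **Setting.** Let $R_y>0$; data entries are pairs $(x,y)\in\mathbb R^p\times[-R_y,R_y]$. The training set $D_1=(\mathbf X_1,\mathbf Y_1)$ and the validation set $D_2=(\mathbf X_2,\mathbf Y_2)$ are lists of $n_1$ and $n_2$ entries. $(D_1,D_2)$ and $(D_1',D_2')$ are neighbours if one is obtained from the other by substituting a single entry in one of the two lists. A randomised algorithm $\mathcal M$ is $(\varepsilon,\delta)$-DP if $\Pr[\mathcal M(D)\in O]\le e^{\varepsilon}\Pr[\mathcal M(D')\in O]+\delta$ for all neighbours $D,D'$ and all measurable $O$. Fix inducing points $\mathbf Z=(z_1,\dots,z_d)$ in $\mathbb R^p$ and candidates $\theta_i=(k_i,\sigma_i)$, $i=1,\dots,K$ ($K\ge1$), each a kernel $k_i$ and a noise level $\sigma_i>0$; a bound $R_{k,i}\ge\|(k_i(z_j,x))_{j}\|_2$ (for all $x$), computed in one of these ways: $\sqrt d\,\sigma_f^2$ when $|k_i|\le\sigma_f^2$; for $k_i(x,x')=\sigma_f^2k_r(\|x-x'\|)$ with $0\le k_r\le1$ decreasing and inducing points at mutual distances at least $d_z>0$, $\sigma_f^2\bigl(1+(d-1)k_r(d_z/2)^2\bigr)^{1/2}$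 or, if $p=1$, $\sigma_f^2\bigl(\sum_{j=0}^{\lfloor d/2\rfloor}2k_r(jd_z)^2+(\lceil d/2\rceil-\lfloor d/2\rfloor)k_r(\lceil d/2\rceil d_z)^2\bigr)^{1/2}$; or any other upper bound, such as the maximum; constants $c>0$ and $\rho,\beta\in(0,1)$. **DP-GP inference** for $\theta=(k,\sigma)$ with privacy parameters $(\varepsilon,\delta)$ on $D_1=((x_i,y_i))_i$. Put $\Delta^2=\frac{R_y^4}{2c^2}+2R_y^2R_k^2+2c^2R_k^4$; let $\sigma_a$ be the least $s>0$ with $\Phi(\frac{\Delta}{2s}-\frac{\varepsilon s}{\Delta})-e^{\varepsilon}\Phi(-\frac{\Delta}{2s}-\frac{\varepsilon s}{\Delta})\le\delta$ ($\Phi$ the standard normal distribution function), and $\sigma_b=\sigma_a/c$. With $\mathbf k_i=(k(z_j,x_i))_j$ let $A=\sum_i y_i\mathbf k_i$, $B=\sum_i\mathbf k_i\mathbf k_i^T$, and let $\hat B$ be the vector of the entries $b_{jj}$ and $\sqrt2\,b_{jl}$ ($j<l$). Add independent noise $N(0,\sigma_a^2)$ to the entries of $A$ and $N(0,\sigma_b^2)$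 to those of $\hat B$; let $\tilde A$ be the noisy $A$ and $\tilde B$ the symmetric matrix reconstructed from the noisy $\hat B$. With $\lambda=\sigma_b\sigma^{-2}\sqrt{d\log(2d^2/\rho)}\,\frac{d+1}{2d}$, $K_{ZZ}=(k(z_j,z_l))$ and $\tilde\Sigma=(K_{ZZ}+\sigma^{-2}\tilde B+\lambda I)^{-1}$, return $\mathbf m=\sigma^{-2}K_{ZZ}\tilde\Sigma\tilde A$ and $$\mathbf S=K_{ZZ}\tilde\Sigma K_{ZZ}+\sigma_a^2\sigma^{-4}K_{ZZ}\tilde\Sigma^2K_{ZZ}+\sum_j\sigma^{-8}\sigma_b^2 P_{jj}+\sum_{j<l}\sigma^{-8}\tfrac{\sigma_b^2}{2}(P_{jl}+P_{lj}),$$ where $P_{jl}=K_{ZZ}\tilde\Sigma E_{jl}\tilde\Sigma\tilde A\tilde A^T\tilde\Sigma E_{lj}\tilde\Sigma K_{ZZ}$ and $E_{jl}$ are the matrix units. **Score** of $(\mathbf m,\mathbf S)$ on $D_2$. For a validation entry $(x_j,y_j)$ let $v_j=\log N(y_j;\mu_j,s_j+\sigma^2)$ with $\mu_j=k_{xZ}K_{ZZ}^{-1}\mathbf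 m$ and $s_j=k(x,x)-k_{xZ}K_{ZZ}^{-1}(K_{ZZ}-\mathbf S)K_{ZZ}^{-1}k_{Zx}$ at $x=x_j$. Let $R=R_y^2/\sigma^2$, $C=-\frac12\log(2\pi)-\log\sigma-R$, and $\rho_{CP}=\bigl(\sqrt{\varepsilon+\log(1/\delta)}-\sqrt{\log(1/\delta)}\bigr)^2$. The score is $\tilde v=n_2\hat\mu$, where $\hat\mu$ is the CoinPress estimate of the mean of the $v_j$ clipped to $[C-R,C+R]$: start with centre $C$ and radius $R$; a step with parameters $(\rho_s,\beta_s)$ from centre $a$ and radius $r$ projects the values to $[a-w,a+w]$, $w=r+\sqrt{2\log(2n_2/\beta_s)}$, takes as new centre their mean plus $N(0,\tau^2)$ noise, $\tau=\frac{2w}{n_2\sqrt{2\rho_s}}$, and as new radius $\sqrt{2(\frac1{n_2}+\tau^2)\log(2/\beta_s)}$; eleven steps use $(\frac{\rho_{CP}}{44},\frac{\beta}{44})$, a twelfth uses $(\frac{3\rho_{CP}}4,\frac\beta4)$, and $\hat\mu$ is the final centre. **Algorithm 2**, with inputs $\varepsilon_{tot}$, $\delta_{tot}\in(0,1]$, $\gamma\in(0,1]$.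 Let $t_0\in(0,1]$ be the root of $t(1-\log t)=\delta_{tot}$, and set $\delta=\gamma^2t_0^2/2$, $\delta_2=\sqrt{2\delta}/\gamma$, $\varepsilon=\varepsilon_{tot}/3-\sqrt{2\delta}$, $T=\frac1\gamma\log\frac1{\delta_2}$; it is assumed that $\varepsilon>0$. Start with $v_{opt}=-\infty$ and no recorded model. At most $\lfloor T\rfloor$ times: draw $i$ uniformly from $\{1,\dots,K\}$; draw $(\mathbf m,\mathbf S)$ by DP-GP inference for $\theta_i$ with $(\varepsilon,\delta)$ on $D_1$; compute its score $\tilde v$ on $D_2$ with $(\varepsilon,\delta)$; if $\tilde v\le C+R$ (for $\sigma=\sigma_i$) and $\tilde v>v_{opt}$, set $v_{opt}=\tilde v$, $m_{opt}=(\mathbf m,\mathbf S)$; then, with probability $\gamma$, stop. Return $(m_{opt},v_{opt})$. **Theorem 4.** Algorithm 2 is $(\varepsilon_{tot},\delta_{tot})$-DP with respect to the combination $(D_1,D_2)$ of the training and validation sets, and its parameters satisfy $$\varepsilon_{tot}=3\varepsilon+3\sqrt{2\delta},\qquad \delta_{tot}=\sqrt{2\delta}\,T+\delta_2 .$$ 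-/

import Mathlib

open MeasureTheory ProbabilityTheory

noncomputable section

namespace DPGP

/-! ## Differential privacy -/

/-- Substitute neighbourhood for data sets of `n` entries: at most one entry is replaced. -/
def SubstNeighbour {α : Type*} {n : ℕ} (D D' : Fin n → α) : Prop :=
  ∃ j, ∀ i, i ≠ j → D i = D' i

/-- Substitute neighbourhood for the combination of a training and a validation set: a single
entry is replaced, in exactly one of the two parts. -/
def CombinedNeighbour {α : Type*} {n₁ n₂ : ℕ}
    (D D' : (Fin n₁ → α) × (Fin n₂ → α)) : Prop :=
  (SubstNeighbour D.1 D'.1 ∧ D.2 = D'.2) ∨ (D.1 = D'.1 ∧ SubstNeighbour D.2 D'.2)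

/-- A randomised algorithm, given by the law `M D` of its output on every data set `D`, is
`(ε, δ)`-differentially private. The first field says that `M D` really is a random output. -/
structure IsDP {𝒟 Ω : Type*} [MeasurableSpace Ω] (nbr : 𝒟 → 𝒟 → Prop)
    (M : 𝒟 → Measure Ω) (ε δ : ℝ) : Prop where
  isProbabilityMeasure : ∀ D, IsProbabilityMeasure (M D)
  le : ∀ D D', nbr D D' → ∀ O : Set Ω, MeasurableSet O →
    M D O ≤ ENNReal.ofReal (Real.exp ε) * M D' O + ENNReal.ofReal δ

/-! ## Data, candidates and algorithm inputs -/

/-- The input space `ℝ^p`. -/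
abbrev Input (p : ℕ) : Type := EuclideanSpace ℝ (Fin p)

/-- A data entry `(x, y)` with `|y| ≤ Ry`. -/
abbrev Entry (p : ℕ) (Ry : ℝ) : Type := Input p × Set.Icc (-Ry) Ry

/-- Published variational approximation `(m, S)` over the values at `d` inducing points. -/
abbrev Model (d : ℕ) : Type := (Fin d → ℝ) × (Fin d → Fin d → ℝ)

/-- A candidate `θ = (k, σ)`: kernel and observation noise level, together with the bound `R_k`
on the norm of `(k(z_j, x))_j` that is used in the sensitivity. -/
structure Candidate (p : ℕ) where
  kernel : Input p → Input p → ℝ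
  noise : ℝ
  kernelBound : ℝ

/-- `‖(k(z_j, x))_j‖₂`. -/
def kernelNorm {p d : ℕ} (k : Input p → Input p → ℝ) (Z : Fin d → Input p) (x : Input p) : ℝ :=
  Real.sqrt (∑ j, k (Z j) x ^ 2)

/-- `k(x, x') = σf² · kr(‖x - x'‖)` is stationary with `0 ≤ kr ≤ 1` decreasing. -/
structure IsDecreasingStationary {p : ℕ} (k : Input p → Input p → ℝ) (σf : ℝ) (kr : ℝ → ℝ) :
    Prop where
  eq : ∀ x x', k x x' = σf ^ 2 * kr ‖x - x'‖
  nonneg : ∀ r, 0 ≤ r → 0 ≤ kr r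
  le_one : ∀ r, 0 ≤ r → kr r ≤ 1
  anti : AntitoneOn kr (Set.Ici 0)

/-- The admissible ways of computing `R_k` for a kernel and inducing points. -/
inductive IsKernelBound {p d : ℕ} (k : Input p → Input p → ℝ) (Z : Fin d → Input p) : ℝ → Prop
  /-- bounded kernel, `|k| ≤ σf²` -/
  | basic (σf : ℝ) (hk : ∀ x x', |k x x'| ≤ σf ^ 2) :
      IsKernelBound k Z (Real.sqrt d * σf ^ 2)
  /-- decreasing stationary kernel in dimension one, inducing points at distances `≥ dz` -/
  | oneDim (hp : p = 1) (σf dz : ℝ) (kr : ℝ → ℝ) (hk : IsDecreasingStationary k σf kr)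
      (hdz : 0 < dz) (hZ : ∀ i j, i ≠ j → dz ≤ ‖Z i - Z j‖) :
      IsKernelBound k Z (σf ^ 2 * Real.sqrt
        (∑ j ∈ Finset.range (d / 2 + 1), 2 * kr (j * dz) ^ 2
          + ((((d + 1) / 2 : ℕ) : ℝ) - ((d / 2 : ℕ) : ℝ)) * kr (((d + 1) / 2 : ℕ) * dz) ^ 2))
  /-- decreasing stationary kernel, any dimension, inducing points at distances `≥ dz` -/
  | multiDim (σf dz : ℝ) (kr : ℝ → ℝ) (hk : IsDecreasingStationary k σf kr)
      (hdz : 0 < dz) (hZ : ∀ i j, i ≠ j → dz ≤ ‖Z i - Z j‖) :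
      IsKernelBound k Z (σf ^ 2 * Real.sqrt (1 + ((d : ℝ) - 1) * kr (dz / 2) ^ 2))
  /-- an upper bound computed directly from the kernel and the inducing points, in particular the
  exact maximum -/
  | direct (R : ℝ) (hR : ∀ x, kernelNorm k Z x ≤ R) : IsKernelBound k Z R

/-- The inputs of the algorithms that are neither private data nor privacy parameters: inducing
points, candidates, the ratio `c = σ_a / σ_b`, the failure probability `ρ` in the choice of the
regularisation `λ`, and the failure probability `β` of the mean estimator. -/
structure Setup (p d K : ℕ) where
  Z : Fin d → Input p
  cand : Fin K → Candidate p
  ratio : ℝ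
  regFail : ℝ
  meanFail : ℝ

/-! ## Analytical Gaussian mechanism -/

/-- Standard normal distribution function. -/
def stdNormalCDF (x : ℝ) : ℝ := cdf (gaussianReal 0 1) x

/-- Noise level of the analytical Gaussian mechanism: the smallest `σ > 0` with
`Φ(Δ/(2σ) - εσ/Δ) - e^ε Φ(-Δ/(2σ) - εσ/Δ) ≤ δ`. -/
def analyticGaussianSigma (Δ ε δ : ℝ) : ℝ :=
  sInf {σ : ℝ | 0 < σ ∧
    stdNormalCDF (Δ / (2 * σ) - ε * σ / Δ)
      - Real.exp ε * stdNormalCDF (-(Δ / (2 * σ)) - ε * σ / Δ) ≤ δ}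

/-! ## DP-GP inference with known hyperparameters -/

section Inference

variable {p d n : ℕ} {Ry : ℝ}

/-- Sensitivity `Δ` for `σ_a / σ_b = c`. -/
def sensitivity (Ry Rk c : ℝ) : ℝ :=
  Real.sqrt (Ry ^ 4 / (2 * c ^ 2) + 2 * Ry ^ 2 * Rk ^ 2 + 2 * c ^ 2 * Rk ^ 4)

/-- `A = K_ZX Y`. -/
def matA (k : Input p → Input p → ℝ) (Z : Fin d → Input p) (D : Fin n → Entry p Ry) :
    Fin d → ℝ :=
  fun a => ∑ i, k (Z a) (D i).1 * ((D i).2 : ℝ)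

/-- `B = K_ZX K_XZ = ∑ᵢ kᵢ kᵢᵀ`. -/
def matB (k : Input p → Input p → ℝ) (Z : Fin d → Input p) (D : Fin n → Entry p Ry) :
    Matrix (Fin d) (Fin d) ℝ :=
  Matrix.of fun a b => ∑ i, k (Z a) (D i).1 * k (Z b) (D i).1

/-- Index set of the upper triangle (with the diagonal) of a `d × d` matrix. -/
abbrev UpperIdx (d : ℕ) : Type := {q : Fin d × Fin d // q.1 ≤ q.2}

/-- The vector of upper triangular entries, off-diagonal ones scaled by `√2`. -/
def upperVec (B : Matrix (Fin d) (Fin d) ℝ) : UpperIdx d → ℝ :=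
  fun q => if q.1.1 = q.1.2 then B q.1.1 q.1.2 else Real.sqrt 2 * B q.1.1 q.1.2

/-- The symmetric matrix with a given vector of scaled upper triangular entries. -/
def symOfUpper (w : UpperIdx d → ℝ) : Matrix (Fin d) (Fin d) ℝ :=
  Matrix.of fun a b =>
    if a = b then w ⟨(min a b, max a b), min_le_max⟩
    else w ⟨(min a b, max a b), min_le_max⟩ / Real.sqrt 2

/-- Gaussian mechanism: law of `(A, B̂)` plus independent centred noise of standard deviation
`σa` on `A` and `σb` on `B̂`. -/
def noisySums (k : Input p → Input p → ℝ) (Z : Fin d → Input p) (σa σb : ℝ)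
    (D : Fin n → Entry p Ry) : Measure ((Fin d → ℝ) × (UpperIdx d → ℝ)) :=
  (Measure.pi fun a => gaussianReal (matA k Z D a) (σa ^ 2).toNNReal).prod
    (Measure.pi fun q => gaussianReal (upperVec (matB k Z D) q) (σb ^ 2).toNNReal)

/-- Regularisation constant `λ`. -/
def regLambda (d : ℕ) (σ σb ρ : ℝ) : ℝ :=
  σb * (σ ^ 2)⁻¹ * Real.sqrt (d * Real.log (2 * (d : ℝ) ^ 2 / ρ)) * ((d + 1) / (2 * d))

/-- `K_ZZ`. -/
def gram (k : Input p → Input p → ℝ) (Z : Fin d → Input p) : Matrix (Fin d) (Fin d) ℝ :=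
  Matrix.of fun a b => k (Z a) (Z b)

/-- Regularised `Σ̃ = (K_ZZ + σ⁻² (B + E_b) + λ I)⁻¹`, from the noisy `B`. -/
def sigmaTilde (KZ B : Matrix (Fin d) (Fin d) ℝ) (σ lam : ℝ) : Matrix (Fin d) (Fin d) ℝ :=
  (KZ + (σ ^ 2)⁻¹ • B + lam • (1 : Matrix (Fin d) (Fin d) ℝ))⁻¹

/-- Posterior covariance contribution `S_{2,1}` of the noise in `A`. -/
def covNoiseA (KZ St : Matrix (Fin d) (Fin d) ℝ) (σ σa : ℝ) : Matrix (Fin d) (Fin d) ℝ :=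
  (σa ^ 2 * (σ ^ 4)⁻¹) • (KZ * (St * St) * KZ)

/-- Posterior covariance contribution `S_{2,2}` of the noise in `B`; `a` is the noisy `A`. -/
def covNoiseB (KZ St : Matrix (Fin d) (Fin d) ℝ) (a : Fin d → ℝ) (σ σb : ℝ) :
    Matrix (Fin d) (Fin d) ℝ :=
  let At : Matrix (Fin d) (Fin d) ℝ := St * Matrix.vecMulVec a a * St
  let E : Fin d → Fin d → Matrix (Fin d) (Fin d) ℝ := fun i j => Matrix.single i j 1
  ∑ i, ((σ ^ 8)⁻¹ * σb ^ 2) • (KZ * St * E i i * At * E i i * St * KZ)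
    + ∑ i, ∑ j ∈ Finset.Ioi i, ((σ ^ 8)⁻¹ * (σb ^ 2 / 2)) •
        (KZ * St * E i j * At * E j i * St * KZ + KZ * St * E j i * At * E i j * St * KZ)

/-- The DP update: `(m, S)` from the noisy sums `w`. -/
def posterior (k : Input p → Input p → ℝ) (Z : Fin d → Input p) (σ σa σb ρ : ℝ)
    (w : (Fin d → ℝ) × (UpperIdx d → ℝ)) : Model d :=
  let KZ := gram k Z
  let St := sigmaTilde KZ (symOfUpper w.2) σ (regLambda d σ σb ρ)
  ((σ ^ 2)⁻¹ • (KZ * St).mulVec w.1,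
    KZ * St * KZ + (covNoiseA KZ St σ σa + covNoiseB KZ St w.1 σ σb))

/-- Law of the output of DP-GP inference with privacy parameters `ε, δ`. -/
def inference (Z : Fin d → Input p) (θ : Candidate p) (c ρ ε δ : ℝ)
    (D : Fin n → Entry p Ry) : Measure (Model d) :=
  let σa := analyticGaussianSigma (sensitivity Ry θ.kernelBound c) ε δ
  let σb := σa / c
  (noisySums θ.kernel Z σa σb D).map (posterior θ.kernel Z θ.noise σa σb ρ)

end Inference

/-! ## Mean estimation by CoinPress -/

section CoinPress

/-- Projection of `v` to the interval with centre `c` and radius `r`. -/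
def clip (c r v : ℝ) : ℝ := max (c - r) (min (c + r) v)

/-- Radius of the interval to which one step projects `n` values, starting from radius `r`. -/
def coinPressClipRadius (n : ℕ) (r β : ℝ) : ℝ := r + Real.sqrt (2 * Real.log (2 * n / β))

/-- Standard deviation `Δ / √(2ρ)` of the noise of one step, where `Δ` is the length of the
projection interval divided by `n`. -/
def coinPressSd (n : ℕ) (r ρ β : ℝ) : ℝ :=
  2 * coinPressClipRadius n r β / n / Real.sqrt (2 * ρ)

/-- Law of the new centre after one step: noisy mean of the projected values. -/
def coinPressStep {n : ℕ} (v : Fin n → ℝ) (c r ρ β : ℝ) : Measure ℝ :=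
  gaussianReal ((∑ j, clip c (coinPressClipRadius n r β) (v j)) / n)
    (coinPressSd n r ρ β ^ 2).toNNReal

/-- New radius after one step. -/
def coinPressRadius (n : ℕ) (r ρ β : ℝ) : ℝ :=
  Real.sqrt (2 * (1 / n + coinPressSd n r ρ β ^ 2) * Real.log (2 / β))

/-- Law of the final centre, for a list of per-step pairs `(ρ_s, β_s)`. -/
def coinPressIter {n : ℕ} (v : Fin n → ℝ) : List (ℝ × ℝ) → ℝ → ℝ → Measure ℝ
  | [], c, _ => Measure.dirac c
  | s :: l, c, r =>
      (coinPressStep v c r s.1 s.2).bind fun c' =>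
        coinPressIter v l c' (coinPressRadius n r s.1 s.2)

/-- Twelve steps: `3/4` of the budget `ρ` for the last step, the rest split evenly between the
first eleven; failure probability `β/4` for the last and `β/(4·11)` for each other step. -/
def coinPressSchedule (ρ β : ℝ) : List (ℝ × ℝ) :=
  List.replicate 11 (ρ / 4 / 11, β / (4 * 11)) ++ [(3 / 4 * ρ, β / 4)]

/-- Law of the CoinPress mean estimate with starting interval `[c - r, c + r]`, total zCDP budget
`ρ` and failure probability `β`. -/
def coinPressMean {n : ℕ} (v : Fin n → ℝ) (c r ρ β : ℝ) : Measure ℝ :=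
  coinPressIter v (coinPressSchedule ρ β) c r

/-- zCDP budget for `(ε, δ)`. -/
def zcdpBudget (ε δ : ℝ) : ℝ :=
  (Real.sqrt (ε + Real.log (1 / δ)) - Real.sqrt (Real.log (1 / δ))) ^ 2

end CoinPress

/-! ## Validation score -/

section Score

variable {p d n : ℕ} {Ry : ℝ}

/-- Logarithm of the density at `y` of the normal law with mean `μ` and variance `v`. -/
def logNormalDensity (y μ v : ℝ) : ℝ :=
  -(1 / 2) * Real.log (2 * Real.pi) - 1 / 2 * Real.log v - (y - μ) ^ 2 / (2 * v)

/-- Predictive mean at `x`. -/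
def predMean (k : Input p → Input p → ℝ) (Z : Fin d → Input p) (M : Model d) (x : Input p) : ℝ :=
  (fun a => k x (Z a)) ⬝ᵥ ((gram k Z)⁻¹.mulVec M.1)

/-- Noise-free predictive variance at `x`. -/
def predVar (k : Input p → Input p → ℝ) (Z : Fin d → Input p) (M : Model d) (x : Input p) : ℝ :=
  k x x - (fun a => k x (Z a)) ⬝ᵥ
    (((gram k Z)⁻¹ * (gram k Z - Matrix.of M.2) * (gram k Z)⁻¹).mulVec fun a => k (Z a) x)

/-- Predictive log-likelihood of a single validation entry. -/
def valLogLik (θ : Candidate p) (Z : Fin d → Input p) (M : Model d) (e : Entry p Ry) : ℝ :=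
  logNormalDensity (e.2 : ℝ) (predMean θ.kernel Z M e.1)
    (predVar θ.kernel Z M e.1 + θ.noise ^ 2)

/-- Radius `R_CP`. -/
def radiusCP (Ry σ : ℝ) : ℝ := Ry ^ 2 / σ ^ 2

/-- Centre `C_CP`. -/
def centreCP (Ry σ : ℝ) : ℝ :=
  -(1 / 2) * Real.log (2 * Real.pi) - Real.log σ - Ry ^ 2 / σ ^ 2

/-- Law of the DP estimate of the validation log-likelihood of the model `M`. -/
def score (Z : Fin d → Input p) (θ : Candidate p) (β ε δ : ℝ)
    (M : Model d) (D : Fin n → Entry p Ry) : Measure ℝ :=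
  let C := centreCP Ry θ.noise
  let R := radiusCP Ry θ.noise
  (coinPressMean (fun j => clip C R (valLogLik θ Z M (D j))) C R (zcdpBudget ε δ) β).map
    fun μ => n * μ

end Score

/-! ## Hyperparameter learning -/

section Learning

variable {p d K n₁ n₂ : ℕ} {Ry : ℝ}

/-- The pair `(m_opt, v_opt)`; the left summand is the initial state, where no model has been
recorded and `v_opt = -∞`. -/
abbrev State (d : ℕ) : Type := Unit ⊕ (Model d × ℝ)

/-- `v_opt`. -/
def State.value (s : State d) : EReal := Sum.elim (fun _ => ⊥) (fun q => ((q.2 : ℝ) : EReal)) s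

open scoped Classical in
/-- Record `(M, v)` if `v ≤ ub` and `v > v_opt`. -/
def State.update (ub : ℝ) (s : State d) (M : Model d) (v : ℝ) : State d :=
  if v ≤ ub ∧ State.value s < (v : EReal) then Sum.inr (M, v) else s

/-- Law of the state after one iteration from `s`: uniform index, inference on the training set,
score on the validation set, update. -/
def iteration (A : Setup p d K) (ε δ : ℝ) (D₁ : Fin n₁ → Entry p Ry) (D₂ : Fin n₂ → Entry p Ry)
    (s : State d) : Measure (State d) :=
  ∑ i : Fin K, (K : ENNReal)⁻¹ •
    (inference A.Z (A.cand i) A.ratio A.regFail ε δ D₁).bind fun M =>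
      (score A.Z (A.cand i) A.meanFail ε δ M D₂).map fun v =>
        State.update (centreCP Ry (A.cand i).noise + radiusCP Ry (A.cand i).noise) s M v

/-- Law of the output when at most `N` iterations remain: after every iteration the algorithm
returns the current state with probability `γ`. -/
def loop (A : Setup p d K) (ε δ γ : ℝ) (D₁ : Fin n₁ → Entry p Ry) (D₂ : Fin n₂ → Entry p Ry) :
    ℕ → State d → Measure (State d)
  | 0, s => Measure.dirac s
  | N + 1, s => (iteration A ε δ D₁ D₂ s).bind fun s' =>
      ENNReal.ofReal γ • Measure.dirac s' + ENNReal.ofReal (1 - γ) • loop A ε δ γ D₁ D₂ N s'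

/-- The root `t₀` of `t (1 - log t) = δtot` in `(0, 1]`. -/
def findRoot (δtot : ℝ) : ℝ := sInf {t : ℝ | 0 < t ∧ t ≤ 1 ∧ t * (1 - Real.log t) = δtot}

/-- Per-candidate `δ = γ² t₀² / 2`. -/
def candDelta (δtot γ : ℝ) : ℝ := γ ^ 2 * findRoot δtot ^ 2 / 2

/-- `δ₂ = √(2δ) / γ`. -/
def stopDelta (δtot γ : ℝ) : ℝ := Real.sqrt (2 * candDelta δtot γ) / γ

/-- Per-candidate `ε = ε_tot / 3 - √(2δ)`. -/
def candEps (εtot δtot γ : ℝ) : ℝ := εtot / 3 - Real.sqrt (2 * candDelta δtot γ)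

/-- `T = (1/γ) log (1/δ₂)`. -/
def maxDraws (δtot γ : ℝ) : ℝ := 1 / γ * Real.log (1 / stopDelta δtot γ)

/-- DP-GP hyperparameter learning: law of `(m_opt, v_opt)` on the training set `D.1` and the
validation set `D.2`. -/
def learnHyperparameters (A : Setup p d K) (εtot δtot γ : ℝ)
    (D : (Fin n₁ → Entry p Ry) × (Fin n₂ → Entry p Ry)) : Measure (State d) :=
  loop A (candEps εtot δtot γ) (candDelta δtot γ) γ D.1 D.2 ⌊maxDraws δtot γ⌋₊ (Sum.inl ())

end Learning

end DPGP

end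

/-!
The proof has two halves: one draw of the algorithm (a candidate index, DP-GP inference on the
training set, a noisy score on the validation set) is `(ε, δ)`-private for the combined data, and
random stopping turns this into `(3 ε + 3 √(2 δ), √(2 δ) T + δ₂)`-privacy of the selected model.

**One draw.** Replacing a training entry changes only the law of the inference, and the score is
post-processing; replacing a validation entry changes only the law of the score, for each model
separately (`close_iteration`). Inference is the analytic Gaussian mechanism. Its sensitivity
bounds the joint change of `A` and `c B̂` (`sum_sq_sub_le_sensitivity`); the privacy loss of two
Gaussian vectors is itself Gaussian, so the worst event is a half-line whose probabilities are
values of `Φ`, and a smaller loss than the calibrated one is padded with an additional coordinate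
(`GaussianLoss.close`, `GaussianLoss.close_of_le`). The score is an adaptive composition of
Gaussian mechanisms. Its Rényi bound is carried in the dual form
`∫ f dP ≤ C (∫ f ^ b dQ) ^ (1 / b)`, which composes by substitution and gives `(ε, δ)`-closeness by
Young's inequality (`HolderClose.bind`, `HolderClose.close`, `close_coinPressMean`).

**Random stopping.** Let `ν` be the law of a draw and let `γ` be the stopping probability. The
probability that the loop is stopped by the coin and returns a model in `O` is
`∫_O γ H(x(y), z(y)) dν(y)`, where `x(y)` and `z(y)` are `(1 - γ)` times the probabilities of a draw
worse than, or not better than, `y`, and `H(x, z)` is the sum of `x ^ i z ^ j` over `i + j < N`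
(`stopMass_eq`). As `(1 - x) ∑_{i < m} x ^ i = 1 - x ^ m` decreases in `x`, a comparison of the
complements `1 - x` up to a factor gives one of the truncated sums, so that the two arguments of
`H` and the measure `ν` contribute the three factors (`close_stopLoop`). The complements are at
least `γ`, and therefore the additive `δ` in their comparison is absorbed by the factor
`e ^ √(2 δ)`. What remains is `δ` for each of the at most `N` draws and the probability
`(1 - γ) ^ N` of reaching the cap, and these fit into `√(2 δ) T + δ₂` in spite of the rounding
`N = ⌊T⌋` (`failure_mass_le`).
-/

noncomputable section

namespace DPGP

/-! ### Approximate domination of measures -/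

section Selection

variable {Ω : Type*} [MeasurableSpace Ω]

/-- One-sided `(ε, δ)`-closeness of two laws, with the multiplicative constant `E = e^ε`. -/
def Close (P Q : Measure Ω) (E D : ENNReal) : Prop :=
  ∀ O : Set Ω, MeasurableSet O → P O ≤ E * Q O + D

/-- Closeness on events extends to bounded test functions, by integration over their level sets. -/
lemma Close.lintegral_le {P Q : Measure Ω} {E D : ENNReal} (h : Close P Q E D)
    {f : Ω → ENNReal} (hf : Measurable f) {F : ENNReal} (hF : F ≠ ⊤) (hfF : ∀ x, f x ≤ F) :
    ∫⁻ x, f x ∂P ≤ E * ∫⁻ x, f x ∂Q + D * F := by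
  have hlayer : ∀ μ : Measure Ω, ∫⁻ x, f x ∂μ =
      ∫⁻ t in Set.Ioi (0 : ℝ), μ {x | t < (f x).toReal} := fun μ => by
    rw [← lintegral_eq_lintegral_meas_lt μ (Filter.Eventually.of_forall fun x =>
      ENNReal.toReal_nonneg) hf.ennreal_toReal.aemeasurable]
    exact lintegral_congr fun x =>
      (ENNReal.ofReal_toReal (ne_top_of_le_ne_top hF (hfF x))).symm
  have hmeas : Measurable fun t : ℝ => Q {x | t < (f x).toReal} := by
    refine Antitone.measurable fun s t hst => measure_mono fun x hx => ?_
    exact lt_of_le_of_lt hst hx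
  rw [hlayer P, hlayer Q, ← lintegral_const_mul _ hmeas]
  have hpt : ∀ t ∈ Set.Ioi (0 : ℝ), P {x | t < (f x).toReal} ≤
      E * Q {x | t < (f x).toReal} + (Set.Ioc 0 F.toReal).indicator (fun _ => D) t := by
    intro t ht
    by_cases htF : t ≤ F.toReal
    · have hmem : t ∈ Set.Ioc 0 F.toReal := ⟨ht, htF⟩
      rw [Set.indicator_of_mem hmem]
      exact h _ (measurableSet_lt measurable_const hf.ennreal_toReal)
    · have : {x | t < (f x).toReal} = ∅ := by
        ext x
        simp only [Set.mem_ofPred_eq, Set.mem_empty_iff_false, iff_false, not_lt]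
        exact (ENNReal.toReal_mono hF (hfF x)).trans (not_le.mp htF).le
      simp [this]
  refine (setLIntegral_mono' measurableSet_Ioi hpt).trans ?_
  rw [lintegral_add_left (hmeas.const_mul _)]
  gcongr
  refine (setLIntegral_le_lintegral _ _).trans ?_
  rw [lintegral_indicator measurableSet_Ioc]
  simp [ENNReal.ofReal_toReal hF]

lemma Close.mono {P Q : Measure Ω} {E D E' D' : ENNReal} (h : Close P Q E D) (hE : E ≤ E')
    (hD : D ≤ D') : Close P Q E' D' := fun O hO => (h O hO).trans (by gcongr)

lemma Close.map {Ω' : Type*} [MeasurableSpace Ω'] {P Q : Measure Ω} {E D : ENNReal}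
    (h : Close P Q E D) {f : Ω → Ω'} (hf : Measurable f) : Close (P.map f) (Q.map f) E D := by
  intro O hO
  rw [Measure.map_apply hf hO, Measure.map_apply hf hO]
  exact h _ (hf hO)

/-- Post-processing by a randomised map. -/
lemma Close.bind {Ω' : Type*} [MeasurableSpace Ω'] {P Q : Measure Ω} {E D : ENNReal}
    (h : Close P Q E D) {κ : Ω → Measure Ω'} (hκ : Measurable κ)
    (hp : ∀ x, IsProbabilityMeasure (κ x)) : Close (P.bind κ) (Q.bind κ) E D := by
  intro O hO
  rw [Measure.bind_apply hO hκ.aemeasurable, Measure.bind_apply hO hκ.aemeasurable]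
  simpa using h.lintegral_le (Measure.measurable_coe hO |>.comp hκ) (F := 1) (by simp)
    fun x => prob_le_one

/-- Mixtures of close laws with the same mixing law are close. -/
lemma Close.bind_right {Ω' : Type*} [MeasurableSpace Ω'] {P : Measure Ω}
    [IsProbabilityMeasure P] {E D : ENNReal} {κ κ' : Ω → Measure Ω'} (hκ : Measurable κ)
    (hκ' : Measurable κ') (h : ∀ x, Close (κ x) (κ' x) E D) :
    Close (P.bind κ) (P.bind κ') E D := by
  intro O hO
  rw [Measure.bind_apply hO hκ.aemeasurable, Measure.bind_apply hO hκ'.aemeasurable]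
  refine (lintegral_mono fun x => h x O hO).trans ?_
  rw [lintegral_add_right _ measurable_const,
    lintegral_const_mul _ (show Measurable fun x => κ' x O from
      Measure.measurable_coe hO |>.comp hκ')]
  simp

/-! ### Truncated geometric sums -/

/-- `∑ x ^ i * y ^ j` over `i + j < N`, defined by splitting off the terms with `i = 0`. -/
def geomSum₂ {R : Type*} [CommSemiring R] : ℕ → R → R → R
  | 0, _, _ => 0
  | N + 1, x, y => ∑ i ∈ Finset.range (N + 1), y ^ i + x * geomSum₂ N x y

lemma geomSum_succ_left {R : Type*} [CommSemiring R] (N : ℕ) (x : R) :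
    ∑ i ∈ Finset.range (N + 1), x ^ i = 1 + x * ∑ i ∈ Finset.range N, x ^ i := by
  rw [Finset.sum_range_succ', Finset.mul_sum, add_comm]
  simp [pow_succ']

lemma geomSum₂_comm {R : Type*} [CommSemiring R] :
    ∀ (N : ℕ) (x y : R), geomSum₂ N x y = geomSum₂ N y x
  | 0, _, _ => rfl
  | 1, _, _ => by simp [geomSum₂]
  | N + 2, x, y => by
    have h1 : geomSum₂ (N + 1) x y = ∑ i ∈ Finset.range (N + 1), x ^ i + y * geomSum₂ N x y := by
      rw [geomSum₂_comm (N + 1) x y, geomSum₂_comm N x y]; rfl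
    have h2 : geomSum₂ (N + 1) y x = ∑ i ∈ Finset.range (N + 1), y ^ i + x * geomSum₂ N x y := by
      rw [← geomSum₂_comm (N + 1) x y]; rfl
    rw [show geomSum₂ (N + 2) x y
        = ∑ i ∈ Finset.range (N + 1 + 1), y ^ i + x * geomSum₂ (N + 1) x y from rfl,
      show geomSum₂ (N + 2) y x
        = ∑ i ∈ Finset.range (N + 1 + 1), x ^ i + y * geomSum₂ (N + 1) y x from rfl, h1, h2,
      geomSum_succ_left (N + 1) x, geomSum_succ_left (N + 1) y]
    ring

open ENNReal in
/-- Comparison of truncated geometric sums by the complements `z = 1 - x`, `z' = 1 - x'` of the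
ratios: the truncated sum times `1 - x` is `1 - x ^ m`, which decreases in `x`. -/
lemma geomSum_le_mul {x x' z z' c : ENNReal} (h : x + z = 1) (h' : x' + z' = 1) (hz : z ≠ 0)
    (hc : 1 ≤ c) (hzz : z' ≤ c * z) (m : ℕ) :
    ∑ i ∈ Finset.range m, x ^ i ≤ c * ∑ i ∈ Finset.range m, x' ^ i := by
  have key : ∀ {x z : ENNReal}, x + z = 1 → z * ∑ i ∈ Finset.range m, x ^ i + x ^ m = 1 := by
    intro x z h
    clear * - h
    induction m with
    | zero => simp
    | succ m ih =>
      calc z * ∑ i ∈ Finset.range (m + 1), x ^ i + x ^ (m + 1)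
          = z * ∑ i ∈ Finset.range m, x ^ i + x ^ m * (x + z) := by
            rw [Finset.sum_range_succ]; ring
        _ = 1 := by rw [h, mul_one, ih]
  rcases le_total x' x with hx | hx
  · have hz1 : z ≠ ⊤ := ne_top_of_le_ne_top one_ne_top (h ▸ le_add_self)
    have hx1 : x' ≠ ⊤ := ne_top_of_le_ne_top one_ne_top (h' ▸ le_self_add)
    have h1 : z * ∑ i ∈ Finset.range m, x ^ i + x' ^ m ≤
        z * (c * ∑ i ∈ Finset.range m, x' ^ i) + x' ^ m := by
      calc z * ∑ i ∈ Finset.range m, x ^ i + x' ^ m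
          ≤ z * ∑ i ∈ Finset.range m, x ^ i + x ^ m := by gcongr
        _ = z' * ∑ i ∈ Finset.range m, x' ^ i + x' ^ m := by rw [key h, key h']
        _ ≤ (c * z) * ∑ i ∈ Finset.range m, x' ^ i + x' ^ m := by gcongr
        _ = _ := by ring
    have h2 := (ENNReal.add_le_add_iff_right (pow_ne_top hx1)).mp h1
    exact (ENNReal.mul_le_mul_iff_right hz hz1).mp h2
  · calc ∑ i ∈ Finset.range m, x ^ i ≤ 1 * ∑ i ∈ Finset.range m, x' ^ i := by
          rw [one_mul]; gcongr
      _ ≤ _ := by gcongr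

lemma geomSum₂_le_mul_right {y y' c : ENNReal} (x : ENNReal)
    (h : ∀ m, ∑ i ∈ Finset.range m, y ^ i ≤ c * ∑ i ∈ Finset.range m, y' ^ i) (N : ℕ) :
    geomSum₂ N x y ≤ c * geomSum₂ N x y' := by
  induction N with
  | zero => simp [geomSum₂]
  | succ N ih =>
    calc geomSum₂ (N + 1) x y ≤ c * ∑ i ∈ Finset.range (N + 1), y' ^ i
          + x * (c * geomSum₂ N x y') := add_le_add (h _) (by gcongr)
      _ = c * geomSum₂ (N + 1) x y' := by rw [geomSum₂]; ring

lemma geomSum₂_le_mul {x x' y y' c : ENNReal}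
    (hx : ∀ m, ∑ i ∈ Finset.range m, x ^ i ≤ c * ∑ i ∈ Finset.range m, x' ^ i)
    (hy : ∀ m, ∑ i ∈ Finset.range m, y ^ i ≤ c * ∑ i ∈ Finset.range m, y' ^ i) (N : ℕ) :
    geomSum₂ N x y ≤ c * c * geomSum₂ N x' y' := by
  calc geomSum₂ N x y ≤ c * geomSum₂ N x y' := geomSum₂_le_mul_right x hy N
    _ = c * geomSum₂ N y' x := by rw [geomSum₂_comm]
    _ ≤ c * (c * geomSum₂ N y' x') := by gcongr; exact geomSum₂_le_mul_right y' hx N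
    _ = c * c * geomSum₂ N x' y' := by rw [geomSum₂_comm N y' x', mul_assoc]

lemma mul_geomSum_le_one {g g' y : ENNReal} (hg : g + g' = 1) (hy : y ≤ g') (m : ℕ) :
    g * ∑ i ∈ Finset.range m, y ^ i ≤ 1 := by
  induction m with
  | zero => simp
  | succ m ih =>
    rw [geomSum_succ_left]
    calc g * (1 + y * ∑ i ∈ Finset.range m, y ^ i)
        = g + y * (g * ∑ i ∈ Finset.range m, y ^ i) := by ring
      _ ≤ g + g' * 1 := by gcongr
      _ = 1 := by rw [mul_one, hg]

lemma mul_geomSum₂_le {g g' x y : ENNReal} (hg : g + g' = 1) (hx : x ≤ 1) (hy : y ≤ g') (N : ℕ) :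
    g * geomSum₂ N x y ≤ N := by
  induction N with
  | zero => simp [geomSum₂]
  | succ N ih =>
    calc g * geomSum₂ (N + 1) x y = g * ∑ i ∈ Finset.range (N + 1), y ^ i
          + x * (g * geomSum₂ N x y) := by rw [geomSum₂]; ring
      _ ≤ 1 + 1 * N := by gcongr; exact mul_geomSum_le_one hg hy _
      _ = ((N + 1 : ℕ) : ENNReal) := by push_cast; ring

lemma measurable_geomSum₂ {f h : Ω → ENNReal} (hf : Measurable f) (hh : Measurable h) (N : ℕ) :
    Measurable fun q => geomSum₂ N (f q) (h q) := by
  induction N with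
  | zero => simp [geomSum₂]
  | succ N ih =>
    simp only [geomSum₂]
    exact (Finset.measurable_sum _ fun i _ => hh.pow_const i).add (hf.mul ih)

end Selection

/-! ### Selection with random stopping -/

section Stopping

variable {Ω : Type*} [MeasurableSpace Ω] (val : Ω → EReal)

open scoped Classical in
/-- The better of a current state `s` and a new draw `q`; ties keep the current state. -/
def keepBest (s q : Ω) : Ω := if val s < val q then q else s

/-- Repeatedly draw from `ν` and keep the best draw, stopping with probability `g` after each of
at most `N` draws; `g'` is the probability of continuing. -/
def stopLoop (ν : Measure Ω) (g g' : ENNReal) : ℕ → Ω → Measure Ω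
  | 0, s => Measure.dirac s
  | N + 1, s => (ν.map (keepBest val s)).bind fun s' =>
      g • Measure.dirac s' + g' • stopLoop ν g g' N s'

/-- Probability that the loop is stopped within its `N` draws by the coin, not by the cap, and
ends in `O`. -/
def stopMass (ν : Measure Ω) (g g' : ENNReal) (O : Set Ω) : ℕ → Ω → ENNReal
  | 0, _ => 0
  | N + 1, s => ∫⁻ q, (g * O.indicator 1 (keepBest val s q)
      + g' * stopMass ν g g' O N (keepBest val s q)) ∂ν

variable {val} {ν : Measure Ω} {g g' : ENNReal} {O : Set Ω}

lemma measurableSet_val_lt (hv : Measurable val) (s : Ω) :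
    MeasurableSet {q | val s < val q} := measurableSet_lt measurable_const hv

lemma measurable_keepBest (hv : Measurable val) :
    Measurable fun p : Ω × Ω => keepBest val p.1 p.2 := by
  unfold keepBest
  exact Measurable.ite (measurableSet_lt (hv.comp measurable_fst) (hv.comp measurable_snd))
    measurable_snd measurable_fst

lemma measurable_keepBest_right (hv : Measurable val) (s : Ω) : Measurable (keepBest val s) :=
  (measurable_keepBest hv).comp (measurable_const.prodMk measurable_id)

lemma measurable_map_keepBest [SFinite ν] (hv : Measurable val) :
    Measurable fun s => ν.map (keepBest val s) := by
  refine Measure.measurable_of_measurable_coe _ fun O hO => ?_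
  simp_rw [Measure.map_apply (measurable_keepBest_right hv _) hO]
  exact measurable_measure_prodMk_left (measurable_keepBest hv hO)

lemma _root_.Measurable.smul_add_smul_measure {α β : Type*} [MeasurableSpace α]
    [MeasurableSpace β] {μ μ' : α → Measure β} (hμ : Measurable μ) (hμ' : Measurable μ')
    (g g' : ENNReal) : Measurable fun a => g • μ a + g' • μ' a := by
  refine Measure.measurable_of_measurable_coe _ fun O hO => ?_
  simp only [Measure.coe_add, Measure.coe_smul, Pi.add_apply, Pi.smul_apply, smul_eq_mul]
  exact ((Measure.measurable_coe hO |>.comp hμ).const_mul g).add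
    ((Measure.measurable_coe hO |>.comp hμ').const_mul g')

lemma measurable_stopLoop [SFinite ν] (hv : Measurable val) (N : ℕ) :
    Measurable (stopLoop val ν g g' N) := by
  induction N with
  | zero => exact Measure.measurable_dirac
  | succ N ih =>
    exact (Measure.measurable_bind' (Measure.measurable_dirac.smul_add_smul_measure ih g g')).comp
      (measurable_map_keepBest hv)

lemma isProbabilityMeasure_stopLoop [IsProbabilityMeasure ν] (hv : Measurable val)
    (hg : g + g' = 1) (N : ℕ) (s : Ω) : IsProbabilityMeasure (stopLoop val ν g g' N s) := by
  induction N generalizing s with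
  | zero => exact Measure.dirac.isProbabilityMeasure
  | succ N ih =>
    have := Measure.isProbabilityMeasure_map (μ := ν)
      (measurable_keepBest_right hv s).aemeasurable
    refine isProbabilityMeasure_bind ((Measure.measurable_dirac.smul_add_smul_measure
      (measurable_stopLoop hv N) g g')).aemeasurable (Filter.Eventually.of_forall fun s' => ⟨?_⟩)
    have := ih s'
    simp [hg]

lemma stopLoop_succ_apply [SFinite ν] (hv : Measurable val) (hO : MeasurableSet O) (N : ℕ)
    (s : Ω) : stopLoop val ν g g' (N + 1) s O =
      ∫⁻ q, (g * O.indicator 1 (keepBest val s q)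
        + g' * stopLoop val ν g g' N (keepBest val s q) O) ∂ν := by
  have hm := Measure.measurable_dirac.smul_add_smul_measure
    (measurable_stopLoop (ν := ν) (g := g) (g' := g') hv N) g g'
  rw [stopLoop, Measure.bind_apply hO hm.aemeasurable,
    lintegral_map (show Measurable fun a => (g • Measure.dirac a + g' • stopLoop val ν g g' N a) O
      from Measure.measurable_coe hO |>.comp hm) (measurable_keepBest_right hv s)]
  simp [Measure.dirac_apply' _ hO]

lemma stopMass_le_stopLoop [SFinite ν] (hv : Measurable val) (hO : MeasurableSet O)
    (N : ℕ) (s : Ω) : stopMass val ν g g' O N s ≤ stopLoop val ν g g' N s O := by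
  induction N generalizing s with
  | zero => simp [stopMass]
  | succ N ih =>
    rw [stopLoop_succ_apply hv hO, stopMass]
    exact lintegral_mono fun q => by gcongr; exact ih _

lemma stopLoop_le_stopMass [IsProbabilityMeasure ν] (hv : Measurable val)
    (hO : MeasurableSet O) (N : ℕ) (s : Ω) :
    stopLoop val ν g g' N s O ≤ stopMass val ν g g' O N s + g' ^ N := by
  induction N generalizing s with
  | zero => simpa [stopMass, stopLoop] using prob_le_one
  | succ N ih =>
    rw [stopLoop_succ_apply hv hO, stopMass]
    calc ∫⁻ q, (g * O.indicator 1 (keepBest val s q)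
          + g' * stopLoop val ν g g' N (keepBest val s q) O) ∂ν
        ≤ ∫⁻ q, ((g * O.indicator 1 (keepBest val s q)
          + g' * stopMass val ν g g' O N (keepBest val s q)) + g' ^ (N + 1)) ∂ν := by
          refine lintegral_mono fun q => ?_
          rw [add_assoc, pow_succ', ← mul_add]
          gcongr
          exact ih _
      _ = _ := by
          rw [lintegral_add_right _ measurable_const]
          simp

lemma measurable_measure_val_lt [SFinite ν] (hv : Measurable val) :
    Measurable fun y => ν {q | val q < val y} :=
  measurable_measure_prodMk_left (s := {p : Ω × Ω | val p.2 < val p.1})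
    (measurableSet_lt (hv.comp measurable_snd) (hv.comp measurable_fst))

lemma measurable_measure_val_le [SFinite ν] (hv : Measurable val) :
    Measurable fun y => ν {q | val q ≤ val y} :=
  measurable_measure_prodMk_left (s := {p : Ω × Ω | val p.2 ≤ val p.1})
    (measurableSet_le (hv.comp measurable_snd) (hv.comp measurable_fst))

variable (val ν g g') in
/-- Density, relative to one draw, of ending with the draw `y` before the cap is reached: the
`i` draws before `y` are worse, the `j` draws after it are not better, and `i + j < N`. -/
def winDensity (N : ℕ) (y : Ω) : ENNReal :=
  g * geomSum₂ N (g' * ν {q | val q < val y}) (g' * ν {q | val q ≤ val y})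

lemma measurable_winDensity [SFinite ν] (hv : Measurable val) (N : ℕ) :
    Measurable (winDensity val ν g g' N) :=
  (measurable_geomSum₂ ((measurable_measure_val_lt hv).const_mul g')
    ((measurable_measure_val_le hv).const_mul g') N).const_mul g

lemma stopMass_eq [SFinite ν] (hv : Measurable val) (hO : MeasurableSet O)
    (N : ℕ) (s : Ω) :
    stopMass val ν g g' O N s =
      O.indicator 1 s * (g * ν {q | val q ≤ val s} *
        ∑ i ∈ Finset.range N, (g' * ν {q | val q ≤ val s}) ^ i)
      + ∫⁻ y in {q | val s < val q}, O.indicator (winDensity val ν g g' N) y ∂ν := by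
  induction N generalizing s with
  | zero =>
    have h : winDensity val ν g g' 0 = 0 := by ext y; simp [winDensity, geomSum₂]
    simp [stopMass, h]
  | succ N ih =>
    set As : Set Ω := {q | val s < val q} with hAs
    have hA : MeasurableSet As := measurableSet_val_lt hv s
    have hAc : Asᶜ = {q | val q ≤ val s} := by ext q; simp [hAs]
    have hW := (measurable_winDensity (ν := ν) (g := g) (g' := g') hv N).indicator hO
    have hin : ∀ q ∈ As, keepBest val s q = q := fun q hq => if_pos hq
    have hout : ∀ q ∈ Asᶜ, keepBest val s q = s := fun q hq => if_neg hq
    have hS : MeasurableSet {p : Ω × Ω | val p.1 < val p.2} :=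
      measurableSet_lt (hv.comp measurable_fst) (hv.comp measurable_snd)
    have h1 : ∀ q, ∫⁻ y in {y | val q < val y}, O.indicator (winDensity val ν g g' N) y ∂ν
        = ∫⁻ y, {p : Ω × Ω | val p.1 < val p.2}.indicator
            (fun p => O.indicator (winDensity val ν g g' N) p.2) (q, y) ∂ν := fun q => by
      rw [← lintegral_indicator (measurableSet_val_lt hv q)]
      rfl
    have hK : Measurable fun q => ∫⁻ y in {y | val q < val y},
        O.indicator (winDensity val ν g g' N) y ∂ν := by
      simp_rw [h1]
      exact Measurable.lintegral_prod_right' ((hW.comp measurable_snd).indicator hS)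
    -- draws after an improving draw `q`, with the order of integration exchanged
    have hswap : ∫⁻ q in As, ∫⁻ y in {y | val q < val y}, O.indicator (winDensity val ν g g' N) y
          ∂ν ∂ν
        = ∫⁻ y in As, ν {q | val s < val q ∧ val q < val y} *
            O.indicator (winDensity val ν g g' N) y ∂ν := by
      simp_rw [h1]
      rw [lintegral_lintegral_swap (f := fun q y => {p : Ω × Ω | val p.1 < val p.2}.indicator
          (fun p => O.indicator (winDensity val ν g g' N) p.2) (q, y))
          (show Measurable _ from (hW.comp measurable_snd).indicator hS).aemeasurable,
        ← lintegral_indicator hA]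
      refine lintegral_congr fun y => ?_
      have h2 : ∫⁻ q in As, {p : Ω × Ω | val p.1 < val p.2}.indicator
              (fun p => O.indicator (winDensity val ν g g' N) p.2) (q, y) ∂ν
          = ν {q | val s < val q ∧ val q < val y} * O.indicator (winDensity val ν g g' N) y := by
        have hm : MeasurableSet {q | val q < val y} := measurableSet_lt hv measurable_const
        calc _ = ∫⁻ q in As, {q | val q < val y}.indicator
              (fun _ => O.indicator (winDensity val ν g g' N) y) q ∂ν := rfl
          _ = _ := by
            rw [lintegral_indicator hm, setLIntegral_const, Measure.restrict_apply hm, mul_comm]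
            congr 2
            ext q
            simp [hAs, and_comm]
      rw [h2]
      by_cases hy : y ∈ As
      · rw [Set.indicator_of_mem hy]
      · rw [Set.indicator_of_notMem hy]
        have : {q | val s < val q ∧ val q < val y} = ∅ := by
          ext q
          simp only [Set.mem_ofPred_eq, Set.mem_empty_iff_false, iff_false, not_and]
          exact fun h h' => hy (h.trans h')
        simp [this]
    have hsplit : ∀ y ∈ As, ν {q | val q < val y} = ν {q | val q ≤ val s}
        + ν {q | val s < val q ∧ val q < val y} := by
      intro y hy
      rw [← measure_union]
      · congr 1
        ext q
        simp only [Set.mem_ofPred_eq, Set.mem_union]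
        constructor
        · intro h
          rcases le_or_gt (val q) (val s) with h' | h'
          · exact Or.inl h'
          · exact Or.inr ⟨h', h⟩
        · rintro (h | h)
          · exact lt_of_le_of_lt h hy
          · exact h.2
      · rw [Set.disjoint_left]
        intro q h h'
        exact absurd h'.1 (not_lt.mpr h)
      · exact hA.inter (measurableSet_lt hv measurable_const)
    have hmid : Measurable fun y => ν {q | val s < val q ∧ val q < val y} :=
      measurable_measure_prodMk_left (s := {p : Ω × Ω | val s < val p.2 ∧ val p.2 < val p.1})
        ((measurableSet_lt measurable_const (hv.comp measurable_snd)).inter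
          (measurableSet_lt (hv.comp measurable_snd) (hv.comp measurable_fst)))
    set w := ν {q | val q ≤ val s} with hw
    have e1 : ∫⁻ q in Asᶜ, (g * O.indicator 1 (keepBest val s q)
        + g' * stopMass val ν g g' O N (keepBest val s q)) ∂ν
        = (g * O.indicator 1 s + g' * stopMass val ν g g' O N s) * w := by
      rw [setLIntegral_congr_fun hA.compl (g := fun _ => g * O.indicator 1 s
        + g' * stopMass val ν g g' O N s) (fun q hq => by simp only [hout q hq]),
        setLIntegral_const, hAc]
    have e2 : ∫⁻ q in As, (g * O.indicator 1 (keepBest val s q)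
        + g' * stopMass val ν g g' O N (keepBest val s q)) ∂ν
        = ∫⁻ q in As, (g * O.indicator 1 q
          + g' * O.indicator (fun q => g * ν {q' | val q' ≤ val q} *
        ∑ i ∈ Finset.range N, (g' * ν {q' | val q' ≤ val q}) ^ i) q) ∂ν
          + g' * ∫⁻ y in As, ν {q | val s < val q ∧ val q < val y} *
            O.indicator (winDensity val ν g g' N) y ∂ν := by
      rw [← hswap, ← lintegral_const_mul _ hK, ← lintegral_add_right _ (hK.const_mul g')]
      refine setLIntegral_congr_fun hA fun q hq => ?_
      simp only [hin q hq, ih q]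
      by_cases hqO : q ∈ O
      · simp [hqO, mul_add, add_assoc]
      · simp [hqO]
    have e3 : ∫⁻ y in As, O.indicator (winDensity val ν g g' (N + 1)) y ∂ν
        = ∫⁻ q in As, (g * O.indicator 1 q
          + g' * O.indicator (fun q => g * ν {q' | val q' ≤ val q} *
        ∑ i ∈ Finset.range N, (g' * ν {q' | val q' ≤ val q}) ^ i) q) ∂ν
          + g' * ∫⁻ y in As, ν {q | val s < val q ∧ val q < val y} *
            O.indicator (winDensity val ν g g' N) y ∂ν
          + g' * w * ∫⁻ y in As, O.indicator (winDensity val ν g g' N) y ∂ν := by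
      have hP : Measurable fun y => ν {q | val s < val q ∧ val q < val y} *
          O.indicator (winDensity val ν g g' N) y := hmid.mul hW
      rw [← lintegral_const_mul _ hP, ← lintegral_const_mul _ hW,
        ← lintegral_add_right _ (hP.const_mul g'),
        ← lintegral_add_right _ (hW.const_mul _)]
      refine setLIntegral_congr_fun hA fun y hy => ?_
      by_cases hyO : y ∈ O
      · simp only [Set.indicator_of_mem hyO, winDensity, geomSum₂, hsplit y hy,
          geomSum_succ_left N, Pi.one_apply]
        ring
      · simp [hyO]
    rw [stopMass, ← lintegral_add_compl _ hA, e1, e2, ih s, e3, geomSum_succ_left N, ← hw]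
    ring

/-- If the lowest value is attained by a single outcome `s`, the loop started at `s` has density
`winDensity` with respect to one draw. -/
lemma stopMass_eq_of_bot [SFinite ν] (hv : Measurable val) (hO : MeasurableSet O) (N : ℕ) {s : Ω}
    (hs : ∀ q, val q ≤ val s ↔ q = s) :
    stopMass val ν g g' O N s = ∫⁻ y, O.indicator (winDensity val ν g g' N) y ∂ν := by
  have hset : {q | val q ≤ val s} = {s} := by ext q; simp [hs]
  have hA := measurableSet_val_lt hv s
  have hAc : {q | val s < val q}ᶜ = {s} := by ext q; simp [← hs]
  have hlt : {q | val q < val s} = ∅ := by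
    ext q
    simp only [Set.mem_ofPred_eq, Set.mem_empty_iff_false, iff_false]
    exact fun h => h.ne (congrArg val ((hs q).mp h.le))
  have hsm : MeasurableSet {s} := hAc ▸ hA.compl
  rw [stopMass_eq hv hO, ← lintegral_add_compl (μ := ν) _ hA, add_comm, hAc, hset]
  congr 1
  rw [setLIntegral_congr_fun hsm (g := fun _ => O.indicator (winDensity val ν g g' N) s)
    (fun q hq => by rw [Set.mem_singleton_iff.mp hq]), setLIntegral_const]
  by_cases h : s ∈ O
  · have h0 : ∀ N (y : ENNReal), geomSum₂ N 0 y = ∑ i ∈ Finset.range N, y ^ i := by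
      intro N y
      cases N <;> simp [geomSum₂]
    simp [h, winDensity, hset, hlt, h0]
    ring
  · simp [h]

/-- Random stopping amplifies closeness of the draws by a factor `3` in the exponent: one factor
for the draw that wins, and one for each of the sums over the draws before and after it. -/
theorem close_stopLoop {ν ν' : Measure Ω} [IsProbabilityMeasure ν] [IsProbabilityMeasure ν']
    (hv : Measurable val) {s : Ω} (hs : ∀ q, val q ≤ val s ↔ q = s) {E E' D : ENNReal}
    (h : Close ν ν' E D) (h' : Close ν' ν E D) (hg : g + g' = 1) (hg0 : g ≠ 0)
    (hE1 : 1 ≤ E') (hE : E ≤ E') (hED : g + g' * D ≤ E' * g) (N : ℕ) :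
    Close (stopLoop val ν g g' N s) (stopLoop val ν' g g' N s) (E * (E' * E'))
      (D * N + g' ^ N) := by
  intro O hO
  have hg'1 : g' ≤ 1 := hg ▸ le_add_self
  have hmulle : ∀ (A : Set Ω), g' * ν A ≤ g' := fun A =>
    (mul_le_mul_right prob_le_one g').trans_eq (mul_one _)
  -- the complements `1 - g' ν A` of the ratios compare with the factor `E'`, without failure mass
  have hratio : ∀ A : Set Ω, MeasurableSet A → ∀ m,
      ∑ i ∈ Finset.range m, (g' * ν A) ^ i ≤ E' * ∑ i ∈ Finset.range m, (g' * ν' A) ^ i := by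
    intro A hA m
    have hz : ∀ (μ : Measure Ω) [IsProbabilityMeasure μ], g' * μ A + (g + g' * μ Aᶜ) = 1 := by
      intro μ _
      calc g' * μ A + (g + g' * μ Aᶜ) = g + g' * (μ A + μ Aᶜ) := by ring
        _ = 1 := by rw [measure_add_measure_compl hA, measure_univ, mul_one, hg]
    refine geomSum_le_mul (hz ν) (hz ν') (by simp [hg0]) hE1 ?_ m
    calc g + g' * ν' Aᶜ ≤ g + g' * (E * ν Aᶜ + D) := by gcongr; exact h' _ hA.compl
      _ = (g + g' * D) + E * (g' * ν Aᶜ) := by ring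
      _ ≤ E' * g + E' * (g' * ν Aᶜ) := by gcongr
      _ = E' * (g + g' * ν Aᶜ) := by ring
  have hW : ∀ y, winDensity val ν g g' N y ≤ E' * E' * winDensity val ν' g g' N y := by
    intro y
    calc winDensity val ν g g' N y ≤ g * (E' * E' * geomSum₂ N (g' * ν' {q | val q < val y})
          (g' * ν' {q | val q ≤ val y})) := by
          unfold winDensity
          gcongr
          exact geomSum₂_le_mul (hratio _ (measurableSet_lt hv measurable_const))
            (hratio _ (measurableSet_le hv measurable_const)) N
      _ = _ := by rw [winDensity]; ring
  have hWN : ∀ y, O.indicator (winDensity val ν g g' N) y ≤ N := fun y =>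
    (Set.indicator_le_self _ _ _).trans
      (mul_geomSum₂_le hg ((hmulle _).trans hg'1) (hmulle _) N)
  have hWm := (measurable_winDensity (ν := ν) (g := g) (g' := g') hv N).indicator hO
  have hWm' := (measurable_winDensity (ν := ν') (g := g) (g' := g') hv N).indicator hO
  calc stopLoop val ν g g' N s O
      ≤ stopMass val ν g g' O N s + g' ^ N := stopLoop_le_stopMass hv hO N s
    _ ≤ (E * ∫⁻ y, O.indicator (winDensity val ν g g' N) y ∂ν' + D * N) + g' ^ N := by
        rw [stopMass_eq_of_bot hv hO N hs]
        gcongr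
        exact h.lintegral_le hWm (by simp) hWN
    _ ≤ (E * ∫⁻ y, E' * E' * O.indicator (winDensity val ν' g g' N) y ∂ν' + D * N) + g' ^ N := by
        gcongr with y
        by_cases hy : y ∈ O
        · simpa [hy] using hW y
        · simp [hy]
    _ = E * (E' * E') * stopMass val ν' g g' O N s + (D * N + g' ^ N) := by
        rw [lintegral_const_mul _ hWm', stopMass_eq_of_bot hv hO N hs]
        ring
    _ ≤ _ := by gcongr; exact stopMass_le_stopLoop hv hO N s

end Stopping

/-! ### Rényi bounds in dual form -/

section Renyi

/-- Two Gaussian laws of the same variance have a log-linear likelihood ratio. -/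
lemma gaussianReal_eq_withDensity (m m' : ℝ) {v : NNReal} (hv : v ≠ 0) :
    gaussianReal m v = (gaussianReal m' v).withDensity fun x =>
      ENNReal.ofReal (Real.exp (((m - m') * x - (m ^ 2 - m' ^ 2) / 2) / v)) := by
  rw [gaussianReal_of_var_ne_zero m hv, gaussianReal_of_var_ne_zero m' hv,
    ← withDensity_mul _ (measurable_gaussianPDF m' v) (by fun_prop)]
  congr 1
  ext x
  have hv' : (v : ℝ) ≠ 0 := by exact_mod_cast hv
  rw [Pi.mul_apply, gaussianPDF, gaussianPDF, ← ENNReal.ofReal_mul (gaussianPDFReal_nonneg _ _ _),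
    gaussianPDFReal, gaussianPDFReal, mul_assoc _ (Real.exp _) (Real.exp _), ← Real.exp_add]
  congr 3
  field_simp
  ring

variable {Ω : Type*} [MeasurableSpace Ω]

/-- Bound on the Rényi divergence of `P` from `Q`, in the dual form given by Hölder's inequality:
if `a` is the exponent conjugate to `b`, it says that the `a`-norm of `dP / dQ` in `L^a(Q)` is at
most `C`. In this form it passes to adaptive compositions without mention of densities. -/
def HolderClose (b : ℝ) (P Q : Measure Ω) (C : ENNReal) : Prop :=
  ∀ f : Ω → ENNReal, Measurable f → ∫⁻ x, f x ∂P ≤ C * (∫⁻ x, f x ^ b ∂Q) ^ (1 / b)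

lemma HolderClose.mono {b : ℝ} {P Q : Measure Ω} {C C' : ENNReal} (h : HolderClose b P Q C)
    (hC : C ≤ C') : HolderClose b P Q C' := fun f hf => (h f hf).trans (by gcongr)

lemma holderClose_dirac {b : ℝ} (hb : 0 < b) (x : Ω) :
    HolderClose b (Measure.dirac x) (Measure.dirac x) 1 := by
  intro f hf
  rw [lintegral_dirac' _ hf, lintegral_dirac' _ (hf.pow_const b), ← ENNReal.rpow_mul, one_mul,
    mul_one_div_cancel hb.ne', ENNReal.rpow_one]

/-- Adaptive composition. -/
lemma HolderClose.bind {Ω' : Type*} [MeasurableSpace Ω'] {b : ℝ} (hb : 0 < b) {P Q : Measure Ω}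
    {C C' : ENNReal} (h : HolderClose b P Q C) {κ κ' : Ω → Measure Ω'} (hκ : Measurable κ)
    (hκ' : Measurable κ') (h' : ∀ x, HolderClose b (κ x) (κ' x) C') :
    HolderClose b (P.bind κ) (Q.bind κ') (C * C') := by
  intro f hf
  have hfb := hf.pow_const b
  have hm : Measurable fun x => (∫⁻ y, f y ^ b ∂κ' x) ^ (1 / b) :=
    ((Measure.measurable_lintegral hfb).comp hκ').pow_const _
  rw [Measure.lintegral_bind hκ.aemeasurable hf.aemeasurable,
    Measure.lintegral_bind hκ'.aemeasurable hfb.aemeasurable]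
  calc ∫⁻ x, ∫⁻ y, f y ∂κ x ∂P ≤ ∫⁻ x, C' * (∫⁻ y, f y ^ b ∂κ' x) ^ (1 / b) ∂P :=
        lintegral_mono fun x => h' x f hf
    _ = C' * ∫⁻ x, (∫⁻ y, f y ^ b ∂κ' x) ^ (1 / b) ∂P := lintegral_const_mul _ hm
    _ ≤ C' * (C * (∫⁻ x, ((∫⁻ y, f y ^ b ∂κ' x) ^ (1 / b)) ^ b ∂Q) ^ (1 / b)) := by
        gcongr
        exact h _ hm
    _ = C * C' * (∫⁻ x, ∫⁻ y, f y ^ b ∂κ' x ∂Q) ^ (1 / b) := by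
        simp_rw [← ENNReal.rpow_mul, one_div_mul_cancel hb.ne', ENNReal.rpow_one]
        ring

/-- Conversion of a Rényi bound to `(ε, δ)`-closeness, by Young's inequality. -/
lemma HolderClose.close {a b : ℝ} (hab : a.HolderConjugate b) {P Q : Measure Ω}
    {C E D : ENNReal} (h : HolderClose b P Q C) (hC : C ≤ E ^ (1 / b) * D ^ (1 / a)) :
    Close P Q E D := by
  intro O hO
  have h1 := h (O.indicator 1) (measurable_one.indicator hO)
  have h2 : ∀ x, O.indicator (1 : Ω → ENNReal) x ^ b = O.indicator 1 x := by
    intro x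
    by_cases hx : x ∈ O <;> simp [hx, hab.symm.pos]
  simp_rw [h2] at h1
  rw [lintegral_indicator_one hO, lintegral_indicator_one hO] at h1
  have hb := hab.symm.pos
  calc P O ≤ C * Q O ^ (1 / b) := h1
    _ ≤ E ^ (1 / b) * D ^ (1 / a) * Q O ^ (1 / b) := by gcongr
    _ = (E * Q O) ^ (1 / b) * D ^ (1 / a) := by
        rw [ENNReal.mul_rpow_of_nonneg _ _ (by positivity)]; ring
    _ ≤ ((E * Q O) ^ (1 / b)) ^ b / ENNReal.ofReal b + (D ^ (1 / a)) ^ a / ENNReal.ofReal a :=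
        ENNReal.young_inequality _ _ hab.symm
    _ = E * Q O / ENNReal.ofReal b + D / ENNReal.ofReal a := by
        rw [← ENNReal.rpow_mul, ← ENNReal.rpow_mul, one_div_mul_cancel hb.ne',
          one_div_mul_cancel hab.pos.ne', ENNReal.rpow_one, ENNReal.rpow_one]
    _ ≤ E * Q O + D := by
        gcongr <;> refine ENNReal.div_le_of_le_mul (le_mul_of_one_le_right' ?_)
        · exact ENNReal.one_le_ofReal.mpr hab.symm.lt.le
        · exact ENNReal.one_le_ofReal.mpr hab.lt.le

lemma holderClose_gaussianReal {a b : ℝ} (hab : a.HolderConjugate b) (m m' : ℝ) {v : NNReal}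
    (hv : v ≠ 0) : HolderClose b (gaussianReal m v) (gaussianReal m' v)
      (ENNReal.ofReal (Real.exp ((a - 1) * ((m - m') ^ 2 / (2 * v))))) := by
  intro f hf
  have hv' : (v : ℝ) ≠ 0 := by exact_mod_cast hv
  set L : ℝ → ENNReal := fun x =>
    ENNReal.ofReal (Real.exp (((m - m') * x - (m ^ 2 - m' ^ 2) / 2) / v)) with hL
  have hLm : Measurable L := by fun_prop
  have hmom : ∫⁻ x, L x ^ a ∂gaussianReal m' v
      = ENNReal.ofReal (Real.exp (a * ((a - 1) * ((m - m') ^ 2 / (2 * v))))) := by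
    have h1 : ∀ x, L x ^ a = ENNReal.ofReal (Real.exp (-(a * (m ^ 2 - m' ^ 2) / (2 * v)))
        * Real.exp ((a * (m - m') / v) * x)) := by
      intro x
      rw [hL, ENNReal.ofReal_rpow_of_pos (Real.exp_pos _), ← Real.exp_mul, ← Real.exp_add]
      congr 2
      field_simp
      ring
    simp_rw [h1]
    have h2 := congrFun (mgf_fun_id_gaussianReal (μ := m') (v := v)) (a * (m - m') / v)
    rw [mgf] at h2
    rw [← ofReal_integral_eq_lintegral_ofReal
      ((integrable_exp_mul_gaussianReal _).const_mul _)
      (Filter.Eventually.of_forall fun x => by positivity), integral_const_mul, h2,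
      ← Real.exp_add]
    congr 2
    field_simp
    ring
  rw [gaussianReal_eq_withDensity m m' hv, lintegral_withDensity_eq_lintegral_mul _ hLm hf]
  refine (ENNReal.lintegral_mul_le_Lp_mul_Lq _ hab hLm.aemeasurable hf.aemeasurable).trans_eq ?_
  rw [hmom, ENNReal.ofReal_rpow_of_pos (Real.exp_pos _), ← Real.exp_mul]
  congr 3
  have ha := hab.pos.ne'
  field_simp

end Renyi

/-! ### CoinPress -/

section MeanEstimation

lemma measurable_bind_param {T Ω Ω' : Type*} [MeasurableSpace T] [MeasurableSpace Ω]
    [MeasurableSpace Ω'] {μ : T → Measure Ω} (hμ : Measurable μ)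
    (hp : ∀ t, IsProbabilityMeasure (μ t)) {κ : T → Ω → Measure Ω'}
    (hκ : Measurable fun p : T × Ω => κ p.1 p.2) : Measurable fun t => (μ t).bind (κ t) := by
  refine Measure.measurable_of_measurable_coe _ fun O hO => ?_
  have h : ∀ t, (μ t).bind (κ t) O = ∫⁻ x, κ t x O ∂μ t := fun t =>
    Measure.bind_apply hO (hκ.comp measurable_prodMk_left).aemeasurable
  simp_rw [h]
  let η : Kernel T Ω := ⟨μ, hμ⟩
  have : IsMarkovKernel η := ⟨hp⟩
  exact Measurable.lintegral_kernel_prod_right (κ := η) (f := fun t x => κ t x O)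
    (Measure.measurable_coe hO |>.comp hκ)

lemma abs_clip_sub_le {c r : ℝ} (hr : 0 ≤ r) (v v' : ℝ) : |clip c r v - clip c r v'| ≤ 2 * r := by
  have h : ∀ v, c - r ≤ clip c r v ∧ clip c r v ≤ c + r := fun v =>
    ⟨le_max_left _ _, max_le (by linarith) (min_le_left _ _)⟩
  rw [abs_le]
  constructor <;> linarith [(h v).1, (h v).2, (h v').1, (h v').2]

lemma measurable_clip {T : Type*} [MeasurableSpace T] {c r v : T → ℝ} (hc : Measurable c)
    (hr : Measurable r) (hv : Measurable v) : Measurable fun t => clip (c t) (r t) (v t) :=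
  (hc.sub hr).max ((hc.add hr).min hv)

variable {n : ℕ}

lemma isProbabilityMeasure_coinPressStep (v : Fin n → ℝ) (c r ρ β : ℝ) :
    IsProbabilityMeasure (coinPressStep v c r ρ β) := by
  unfold coinPressStep; infer_instance

lemma measurable_coinPressStep {T : Type*} [MeasurableSpace T] {v : T → Fin n → ℝ}
    (hv : ∀ j, Measurable fun t => v t j) {c : T → ℝ} (hc : Measurable c) (r ρ β : ℝ) :
    Measurable fun t => coinPressStep (v t) (c t) r ρ β := by
  unfold coinPressStep
  refine measurable_gaussianReal.comp (Measurable.prodMk (Measurable.div_const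
    (Finset.measurable_sum _ fun j _ => ?_) _) measurable_const)
  exact measurable_clip hc measurable_const (hv j)

lemma measurable_coinPressIter (l : List (ℝ × ℝ)) :
    ∀ {T : Type} [MeasurableSpace T] {v : T → Fin n → ℝ}
    (_ : ∀ j, Measurable fun t => v t j) {c : T → ℝ} (_ : Measurable c) (r : ℝ),
    Measurable fun t => coinPressIter (v t) l (c t) r := by
  induction l with
  | nil => intro T _ v hv c hc r; exact Measure.measurable_dirac.comp hc
  | cons s l ih =>
    intro T _ v hv c hc r
    exact measurable_bind_param (measurable_coinPressStep hv hc r s.1 s.2)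
      (fun t => isProbabilityMeasure_coinPressStep _ _ _ _ _)
      (ih (v := fun p : T × ℝ => v p.1) (fun j => (hv j).comp measurable_fst) measurable_snd _)

lemma isProbabilityMeasure_coinPressIter (v : Fin n → ℝ) (l : List (ℝ × ℝ)) (c r : ℝ) :
    IsProbabilityMeasure (coinPressIter v l c r) := by
  induction l generalizing c r with
  | nil => exact Measure.dirac.isProbabilityMeasure
  | cons s l ih =>
    have := isProbabilityMeasure_coinPressStep v c r s.1 s.2
    exact isProbabilityMeasure_bind (measurable_coinPressIter l (v := fun _ : ℝ => v)
      (fun _ => measurable_const) measurable_id _).aemeasurable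
      (Filter.Eventually.of_forall fun c' => ih _ _)

/-- The noise of a step is calibrated to the change `2 w / n` that one value can make to the mean
of the values clipped to an interval of radius `w`. -/
lemma holderClose_coinPressStep {a b : ℝ} (hab : a.HolderConjugate b) {v v' : Fin n → ℝ}
    (h : SubstNeighbour v v') (c : ℝ) {r ρ β : ℝ} (hr : 0 ≤ r) (hρ : 0 < ρ)
    (hβ : 0 < β ∧ β < 1) :
    HolderClose b (coinPressStep v c r ρ β) (coinPressStep v' c r ρ β)
      (ENNReal.ofReal (Real.exp ((a - 1) * ρ))) := by
  obtain ⟨j, hj⟩ := h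
  have hn : (1 : ℝ) ≤ n := by exact_mod_cast Fin.pos j
  set w := coinPressClipRadius n r β with hw
  have hwpos : 0 < w := by
    have : 0 < Real.log (2 * n / β) := Real.log_pos (by rw [lt_div_iff₀ hβ.1]; linarith)
    rw [hw, coinPressClipRadius]
    positivity
  have hsd : coinPressSd n r ρ β ^ 2 = (2 * w / n) ^ 2 / (2 * ρ) := by
    rw [coinPressSd, div_pow, Real.sq_sqrt (by positivity)]
  have hsdpos : 0 < coinPressSd n r ρ β ^ 2 := by rw [hsd]; positivity
  refine (holderClose_gaussianReal hab _ _ (by simpa using hsdpos.ne')).mono ?_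
  refine ENNReal.ofReal_le_ofReal (Real.exp_le_exp.mpr ?_)
  have ha := hab.sub_one_pos
  rw [Real.coe_toNNReal _ hsdpos.le, hsd]
  refine mul_le_mul_of_nonneg_left ?_ ha.le
  have hdiff : ∑ i, clip c w (v i) - ∑ i, clip c w (v' i) = clip c w (v j) - clip c w (v' j) := by
    rw [← Finset.sum_sub_distrib]
    refine Finset.sum_eq_single_of_mem j (Finset.mem_univ _) fun i _ hi => ?_
    rw [hj i hi, sub_self]
  rw [← sub_div, hdiff]
  have hsq : ((clip c w (v j) - clip c w (v' j)) / n) ^ 2 ≤ (2 * w / n) ^ 2 := by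
    rw [sq_le_sq, abs_div, abs_div, abs_of_pos (show 0 < 2 * w by positivity)]
    gcongr
    exact abs_clip_sub_le hwpos.le _ _
  rw [div_le_iff₀ (by positivity)]
  calc _ ≤ (2 * w / n) ^ 2 := hsq
    _ = _ := by field_simp

lemma holderClose_coinPressIter {a b : ℝ} (hab : a.HolderConjugate b) {v v' : Fin n → ℝ}
    (h : SubstNeighbour v v') (l : List (ℝ × ℝ))
    (hl : ∀ s ∈ l, 0 < s.1 ∧ 0 < s.2 ∧ s.2 < 1) (c : ℝ) {r : ℝ} (hr : 0 ≤ r) :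
    HolderClose b (coinPressIter v l c r) (coinPressIter v' l c r)
      (ENNReal.ofReal (Real.exp ((a - 1) * (l.map Prod.fst).sum))) := by
  induction l generalizing c r with
  | nil => simpa [coinPressIter] using holderClose_dirac hab.symm.pos c
  | cons s l ih =>
    have hs := hl s (by simp)
    have hm : ∀ v : Fin n → ℝ, Measurable fun c' =>
        coinPressIter v l c' (coinPressRadius n r s.1 s.2) := fun v =>
      measurable_coinPressIter l (v := fun _ : ℝ => v) (fun _ => measurable_const) measurable_id _
    rw [List.map_cons, List.sum_cons, mul_add, Real.exp_add,
      ENNReal.ofReal_mul (Real.exp_pos _).le]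
    exact (holderClose_coinPressStep hab h c hr hs.1 hs.2).bind hab.symm.pos (hm v) (hm v')
      fun c' => ih (fun s hs => hl s (List.mem_cons_of_mem _ hs)) c' (Real.sqrt_nonneg _)

lemma sum_coinPressSchedule (ρ β : ℝ) : ((coinPressSchedule ρ β).map Prod.fst).sum = ρ := by
  simp [coinPressSchedule]
  ring

/-- The CoinPress mean is `(ε, δ)`-private. With `L = log (1 / δ)` and the budget `ρ`, the Rényi
order `1 + √(L / ρ)` makes the conversion exact: `√ρ = √(ε + L) - √L` says that
`ε = ρ + 2 √(ρ L)`. -/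
lemma close_coinPressMean {v v' : Fin n → ℝ} (h : SubstNeighbour v v') (c : ℝ) {r β ε δ : ℝ}
    (hr : 0 ≤ r) (hβ : 0 < β ∧ β < 1) (hε : 0 < ε) (hδ : 0 < δ ∧ δ < 1) :
    Close (coinPressMean v c r (zcdpBudget ε δ) β) (coinPressMean v' c r (zcdpBudget ε δ) β)
      (ENNReal.ofReal (Real.exp ε)) (ENNReal.ofReal δ) := by
  set L := Real.log (1 / δ) with hL
  have hLpos : 0 < L := Real.log_pos (by rw [lt_div_iff₀ hδ.1]; linarith [hδ.2])
  set q := Real.sqrt (ε + L) - Real.sqrt L with hq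
  have hqpos : 0 < q := sub_pos.mpr (Real.sqrt_lt_sqrt hLpos.le (by linarith))
  have hρ : zcdpBudget ε δ = q ^ 2 := rfl
  set t := Real.sqrt L with ht
  have htpos : 0 < t := Real.sqrt_pos.mpr hLpos
  have htL : t ^ 2 = L := Real.sq_sqrt hLpos.le
  have hεq : ε = q ^ 2 + 2 * q * t := by
    have : (q + t) ^ 2 = ε + L := by
      rw [hq, sub_add_cancel, Real.sq_sqrt (by positivity)]
    nlinarith
  have ha : 1 < 1 + t / q := by linarith [div_pos htpos hqpos]
  have hab := Real.HolderConjugate.conjExponent ha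
  set a := 1 + t / q with ha'
  set b := a.conjExponent
  rw [coinPressMean, coinPressMean]
  refine (holderClose_coinPressIter hab h _ ?_ c hr).close hab ?_
  · intro s hs
    have hβ1 := hβ.1
    have hβ2 := hβ.2
    simp only [coinPressSchedule, List.mem_append, List.mem_replicate, List.mem_singleton] at hs
    rw [hρ] at hs
    rcases hs with ⟨-, rfl⟩ | rfl
    · exact ⟨by positivity, by positivity, by show β / _ < 1; linarith⟩
    · exact ⟨by positivity, by positivity, by show β / _ < 1; linarith⟩
  · rw [sum_coinPressSchedule, hρ, ENNReal.ofReal_rpow_of_pos (Real.exp_pos _),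
      ENNReal.ofReal_rpow_of_pos hδ.1, ← ENNReal.ofReal_mul (by positivity)]
    have hδe : δ = Real.exp (-L) := by
      rw [hL, one_div, Real.log_inv, neg_neg, Real.exp_log hδ.1]
    rw [hδe, ← Real.exp_mul, ← Real.exp_mul, ← Real.exp_add]
    refine ENNReal.ofReal_le_ofReal (Real.exp_le_exp.mpr (le_of_eq ?_))
    have hb : 1 / b = 1 - 1 / a := by
      have := hab.inv_add_inv_eq_one
      rw [one_div, one_div]; linarith
    have hane : a ≠ 0 := by positivity
    have e : a = (q + t) / q := by rw [ha']; field_simp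
    rw [hb, hεq, ← htL, e]
    field_simp
    ring

end MeanEstimation

/-! ### The analytic Gaussian mechanism -/

section PrivacyLoss

variable {Ω Ω' : Type*} [MeasurableSpace Ω] [MeasurableSpace Ω']

/-- The privacy loss `log (dP / dQ)` is Gaussian with variance `η` and, under `Q`, mean `-η / 2`,
as it is for two Gaussian vectors with the same covariance. -/
def GaussianLoss (P Q : Measure Ω) (η : NNReal) : Prop :=
  ∃ L : Ω → ℝ, Measurable L ∧ P = Q.withDensity (fun x => ENNReal.ofReal (Real.exp (L x))) ∧
    Q.map L = gaussianReal (-(η / 2)) η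

lemma gaussianLoss_self (P : Measure Ω) [IsProbabilityMeasure P] : GaussianLoss P P 0 := by
  refine ⟨fun _ => 0, measurable_const, ?_, ?_⟩
  · simp
  · rw [Measure.map_const, measure_univ, one_smul, gaussianReal_zero_var]
    simp

lemma gaussianLoss_gaussianReal (m m' : ℝ) {v η : NNReal} (hv : v ≠ 0)
    (hη : (η : ℝ) = (m - m') ^ 2 / v) :
    GaussianLoss (gaussianReal m v) (gaussianReal m' v) η := by
  have hv' : (v : ℝ) ≠ 0 := by exact_mod_cast hv
  refine ⟨_, by fun_prop, gaussianReal_eq_withDensity m m' hv, ?_⟩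
  have h : (fun x : ℝ => ((m - m') * x - (m ^ 2 - m' ^ 2) / 2) / v)
      = (fun x => x - (m ^ 2 - m' ^ 2) / (2 * v)) ∘ fun x => ((m - m') / v) * x := by
    ext x
    simp only [Function.comp]
    field_simp
  rw [h, ← Measure.map_map (by fun_prop) (by fun_prop), gaussianReal_map_const_mul,
    gaussianReal_map_sub_const]
  congr 1
  · rw [hη]; field_simp; ring
  · ext
    rw [hη]
    push_cast
    show ((m - m') / v) ^ 2 * (v : ℝ) = _
    field_simp

lemma GaussianLoss.prod {P Q : Measure Ω} {P' Q' : Measure Ω'} [SFinite Q] [SFinite Q']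
    {η η' : NNReal} (h : GaussianLoss P Q η) (h' : GaussianLoss P' Q' η') :
    GaussianLoss (P.prod P') (Q.prod Q') (η + η') := by
  obtain ⟨L, hL, rfl, hQ⟩ := h
  obtain ⟨L', hL', rfl, hQ'⟩ := h'
  refine ⟨fun p => L p.1 + L' p.2, by fun_prop, ?_, ?_⟩
  · rw [prod_withDensity (by fun_prop) (by fun_prop)]
    congr 1
    ext p
    rw [Real.exp_add, ENNReal.ofReal_mul (Real.exp_pos _).le]
  · have h : (fun p : Ω × Ω' => L p.1 + L' p.2) = (fun q : ℝ × ℝ => q.1 + q.2) ∘ Prod.map L L' :=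
      rfl
    rw [h, ← Measure.map_map (by fun_prop) (hL.prodMap hL'), ← Measure.map_prod_map _ _ hL hL',
      hQ, hQ']
    have := gaussianReal_conv_gaussianReal (m₁ := -(η / 2 : ℝ)) (m₂ := -(η' / 2 : ℝ))
      (v₁ := η) (v₂ := η')
    rw [Measure.conv] at this
    rw [this]
    congr 1
    push_cast
    ring

lemma GaussianLoss.map_equiv {P Q : Measure Ω} {η : NNReal} (h : GaussianLoss P Q η)
    (e : Ω ≃ᵐ Ω') : GaussianLoss (P.map e) (Q.map e) η := by
  obtain ⟨L, hL, rfl, hQ⟩ := h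
  refine ⟨L ∘ e.symm, hL.comp e.symm.measurable, ?_, ?_⟩
  · ext O hO
    rw [Measure.map_apply e.measurable hO, withDensity_apply _ (e.measurable hO),
      withDensity_apply _ hO, setLIntegral_map hO (by fun_prop) e.measurable]
    simp
  · rw [Measure.map_map (hL.comp e.symm.measurable) e.measurable, Function.comp_assoc]
    simpa using hQ

lemma gaussianLoss_pi_fin {n : ℕ} (m m' : Fin n → ℝ) {v : NNReal} (hv : v ≠ 0) {η : NNReal}
    (hη : (η : ℝ) = (∑ i, (m i - m' i) ^ 2) / v) :
    GaussianLoss (Measure.pi fun i => gaussianReal (m i) v)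
      (Measure.pi fun i => gaussianReal (m' i) v) η := by
  induction n generalizing η with
  | zero =>
    have h0 : η = 0 := by ext; simp [hη]
    rw [h0, Subsingleton.elim m m']
    exact gaussianLoss_self _
  | succ n ih =>
    let η₁ : NNReal := ⟨(m 0 - m' 0) ^ 2 / v, by positivity⟩
    let η₂ : NNReal := ⟨(∑ i : Fin n, (m i.succ - m' i.succ) ^ 2) / v, by positivity⟩
    have hsum : η = η₁ + η₂ := by
      ext
      rw [hη, Fin.sum_univ_succ, add_div]
      rfl
    have h := (gaussianLoss_gaussianReal (m 0) (m' 0) hv (η := η₁) rfl).prod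
      (ih (fun i => m i.succ) (fun i => m' i.succ) (η := η₂) rfl)
    have hp := fun m : Fin (n + 1) → ℝ =>
      ((measurePreserving_piFinSuccAbove (fun i => gaussianReal (m i) v) 0).symm).map_eq
    rw [hsum, ← hp m, ← hp m']
    exact h.map_equiv _

lemma gaussianLoss_pi {ι : Type*} [Fintype ι] (m m' : ι → ℝ) {v : NNReal} (hv : v ≠ 0)
    {η : NNReal} (hη : (η : ℝ) = (∑ i, (m i - m' i) ^ 2) / v) :
    GaussianLoss (Measure.pi fun i => gaussianReal (m i) v)
      (Measure.pi fun i => gaussianReal (m' i) v) η := by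
  let f := (Fintype.equivFin ι).symm
  have hp := fun m : ι → ℝ =>
    (measurePreserving_piCongrLeft (fun i => gaussianReal (m i) v) f).map_eq
  rw [← hp m, ← hp m']
  refine (gaussianLoss_pi_fin (fun i => m (f i)) (fun i => m' (f i)) hv ?_).map_equiv _
  rw [hη, f.sum_comp fun i => (m i - m' i) ^ 2]

lemma continuous_stdNormalCDF : Continuous stdNormalCDF := by
  refine continuous_iff_continuousAt.mpr fun x => ?_
  have hright : ContinuousWithinAt (cdf (gaussianReal 0 1)) (Set.Ici x) x :=
    (cdf (gaussianReal 0 1)).right_continuous x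
  have := nullSingletonClass_gaussianReal (μ := 0) (v := 1) one_ne_zero
  have hjump := (cdf (gaussianReal 0 1)).measure_singleton x
  rw [measure_cdf, measure_singleton, eq_comm, ENNReal.ofReal_eq_zero, sub_nonpos] at hjump
  have hle := (cdf (gaussianReal 0 1)).mono.leftLim_le (le_refl x)
  have hleft := (cdf (gaussianReal 0 1)).mono.tendsto_leftLim x
  rw [le_antisymm hle hjump] at hleft
  exact continuousAt_iff_continuous_left'_right'.mpr
    ⟨hleft, hright.mono Set.Ioi_subset_Ici_self⟩

/-- Upper tail of a Gaussian law of standard deviation `t`. -/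
lemma gaussianReal_Ioi (m ε : ℝ) {t : ℝ} (ht : 0 < t) {η : NNReal} (hη : (η : ℝ) = t ^ 2) :
    gaussianReal m η (Set.Ioi ε) = ENNReal.ofReal (stdNormalCDF ((m - ε) / t)) := by
  have h1 : gaussianReal m η = (gaussianReal 0 1).map fun x => m - t * x := by
    have h : (fun x : ℝ => m - t * x) = (fun x => x + m) ∘ fun x => (-t) * x := by
      ext x; simp; ring
    rw [h, ← Measure.map_map (by fun_prop) (by fun_prop), gaussianReal_map_const_mul,
      gaussianReal_map_add_const]
    congr 1
    · simp
    · ext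
      rw [hη]
      simp
  have := nullSingletonClass_gaussianReal (μ := 0) (v := 1) one_ne_zero
  rw [h1, Measure.map_apply (by fun_prop) measurableSet_Ioi, stdNormalCDF, ofReal_cdf,
    ← measure_congr Iio_ae_eq_Iic]
  congr 1
  ext x
  simp only [Set.mem_preimage, Set.mem_Ioi, Set.mem_Iio]
  rw [lt_div_iff₀ ht]
  constructor <;> intro h <;> linarith

/-- The worst event for a pair of laws is that the privacy loss exceeds `ε`. -/
lemma GaussianLoss.close {P Q : Measure Ω} [IsProbabilityMeasure P] [IsProbabilityMeasure Q]
    {η : NNReal} (h : GaussianLoss P Q η) {t : ℝ} (ht : 0 < t) (hη : (η : ℝ) = t ^ 2) {ε δ : ℝ}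
    (hδ : stdNormalCDF (t / 2 - ε / t) - Real.exp ε * stdNormalCDF (-(t / 2) - ε / t) ≤ δ) :
    Close P Q (ENNReal.ofReal (Real.exp ε)) (ENNReal.ofReal δ) := by
  obtain ⟨L, hL, hP, hQ⟩ := h
  set l : Ω → ENNReal := fun x => ENNReal.ofReal (Real.exp (L x)) with hl
  have hlm : Measurable l := by fun_prop
  have hη0 : η ≠ 0 := by
    rintro rfl
    exact (pow_pos ht 2).ne' (by simpa using hη.symm)
  have hη0' : (η : ℝ) ≠ 0 := by exact_mod_cast hη0
  have hPL : P.map L = gaussianReal (η / 2) η := by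
    rw [gaussianReal_eq_withDensity (η / 2) (-(η / 2)) hη0, ← hQ]
    ext A hA
    rw [Measure.map_apply hL hA, withDensity_apply _ hA, setLIntegral_map hA (by fun_prop) hL, hP,
      withDensity_apply _ (hL hA)]
    refine lintegral_congr fun x => ?_
    simp only [hl]
    congr 2
    field_simp
    ring
  set B : Set Ω := L ⁻¹' Set.Ioi ε with hB
  have hBm : MeasurableSet B := hL measurableSet_Ioi
  have hPB : P B = ENNReal.ofReal (stdNormalCDF (t / 2 - ε / t)) := by
    rw [hB, ← Measure.map_apply hL measurableSet_Ioi, hPL, gaussianReal_Ioi _ _ ht hη, hη]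
    congr 2
    field_simp
  have hQB : Q B = ENNReal.ofReal (stdNormalCDF (-(t / 2) - ε / t)) := by
    rw [hB, ← Measure.map_apply hL measurableSet_Ioi, hQ, gaussianReal_Ioi _ _ ht hη, hη]
    congr 2
    field_simp
  set E := ENNReal.ofReal (Real.exp ε) with hE
  have hnn : ∀ x, 0 ≤ stdNormalCDF x := fun x => cdf_nonneg _ x
  have hPQ : P B ≤ E * Q B + ENNReal.ofReal δ := by
    rw [hPB, hQB, hE, ← ENNReal.ofReal_mul (Real.exp_pos _).le]
    refine (ENNReal.ofReal_le_ofReal (by linarith)).trans (ENNReal.ofReal_add_le)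
  intro O hO
  have hout : P (O \ B) ≤ E * Q (O \ B) := by
    rw [hP, withDensity_apply _ (hO.diff hBm), ← setLIntegral_const]
    refine setLIntegral_mono' (hO.diff hBm) fun x hx => ?_
    have hx' : L x ≤ ε := not_lt.mp hx.2
    exact ENNReal.ofReal_le_ofReal (Real.exp_le_exp.mpr hx')
  have hin : E * Q (B \ O) ≤ P (B \ O) := by
    rw [hP, withDensity_apply _ (hBm.diff hO), ← setLIntegral_const]
    refine setLIntegral_mono' (hBm.diff hO) fun x hx => ?_
    have hx' : ε < L x := hx.1
    exact ENNReal.ofReal_le_ofReal (Real.exp_le_exp.mpr hx'.le)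
  have hcancel : P (B ∩ O) + E * Q (B \ O)
      ≤ (E * Q (B ∩ O) + ENNReal.ofReal δ) + E * Q (B \ O) := by
    calc P (B ∩ O) + E * Q (B \ O) ≤ P (B ∩ O) + P (B \ O) := by gcongr
      _ = P B := measure_inter_add_sdiff B hO
      _ ≤ E * Q B + ENNReal.ofReal δ := hPQ
      _ = _ := by rw [← measure_inter_add_sdiff (μ := Q) B hO]; ring
  have hcancel' : P (B ∩ O) ≤ E * Q (B ∩ O) + ENNReal.ofReal δ :=
    (ENNReal.add_le_add_iff_right (ENNReal.mul_ne_top ENNReal.ofReal_ne_top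
      (measure_ne_top _ _))).mp hcancel
  calc P O = P (B ∩ O) + P (O \ B) := by
        rw [Set.inter_comm]; exact (measure_inter_add_sdiff O hBm).symm
    _ ≤ (E * Q (B ∩ O) + ENNReal.ofReal δ) + E * Q (O \ B) := by gcongr
    _ = E * (Q (O ∩ B) + Q (O \ B)) + ENNReal.ofReal δ := by rw [Set.inter_comm B O]; ring
    _ = E * Q O + ENNReal.ofReal δ := by rw [measure_inter_add_sdiff O hBm]

/-- A smaller privacy loss is raised to the one the noise is calibrated to by an additional
independent coordinate, which is then forgotten. -/
lemma GaussianLoss.close_of_le {P Q : Measure Ω} [IsProbabilityMeasure P]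
    [IsProbabilityMeasure Q] {η : NNReal} (h : GaussianLoss P Q η) {t : ℝ} (ht : 0 < t)
    (hη : (η : ℝ) ≤ t ^ 2) {ε δ : ℝ}
    (hδ : stdNormalCDF (t / 2 - ε / t) - Real.exp ε * stdNormalCDF (-(t / 2) - ε / t) ≤ δ) :
    Close P Q (ENNReal.ofReal (Real.exp ε)) (ENNReal.ofReal δ) := by
  let η' : NNReal := ⟨t ^ 2 - η, sub_nonneg.mpr hη⟩
  have hpad : GaussianLoss (gaussianReal (Real.sqrt η') 1) (gaussianReal 0 1) η' :=
    gaussianLoss_gaussianReal _ _ one_ne_zero (by simp)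
  have hc := ((h.prod hpad).close ht (by push_cast; exact add_sub_cancel _ _) hδ).map
    measurable_fst
  simpa [Measure.map_fst_prod] using hc

open Filter Topology in
/-- The noise level of the analytic Gaussian mechanism is positive, and the infimum defining it
is attained. -/
lemma analyticGaussianSigma_spec {Δ ε δ : ℝ} (hΔ : 0 < Δ) (hε : 0 < ε) (hδ : 0 < δ ∧ δ < 1) :
    0 < analyticGaussianSigma Δ ε δ ∧
      stdNormalCDF (Δ / (2 * analyticGaussianSigma Δ ε δ) - ε * analyticGaussianSigma Δ ε δ / Δ)
        - Real.exp ε * stdNormalCDF (-(Δ / (2 * analyticGaussianSigma Δ ε δ))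
          - ε * analyticGaussianSigma Δ ε δ / Δ) ≤ δ := by
  set h : ℝ → ℝ := fun s => stdNormalCDF (Δ / (2 * s) - ε * s / Δ)
    - Real.exp ε * stdNormalCDF (-(Δ / (2 * s)) - ε * s / Δ) with hh
  set S : Set ℝ := {s | 0 < s ∧ h s ≤ δ} with hS
  have hdef : analyticGaussianSigma Δ ε δ = sInf S := rfl
  have hbdd : BddBelow S := ⟨0, fun s hs => hs.1.le⟩
  have hdiv0 : Tendsto (fun s : ℝ => Δ / (2 * s)) (𝓝[>] 0) atTop := by
    have : (fun s : ℝ => Δ / (2 * s)) = fun s => Δ / 2 * s⁻¹ := by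
      ext s; rw [← div_div, div_eq_mul_inv]
    rw [this]
    exact tendsto_inv_nhdsGT_zero.const_mul_atTop (by positivity)
  have hlin0 : Tendsto (fun s : ℝ => ε * s / Δ) (𝓝[>] 0) (𝓝 0) := by
    have : Continuous fun s : ℝ => ε * s / Δ := by fun_prop
    have := (this.tendsto 0).mono_left (nhdsWithin_le_nhds (s := Set.Ioi 0))
    simpa using this
  have hbot : Tendsto stdNormalCDF atBot (𝓝 0) := tendsto_cdf_atBot _
  have htop : Tendsto stdNormalCDF atTop (𝓝 1) := tendsto_cdf_atTop _
  have hzero : Tendsto h (𝓝[>] 0) (𝓝 1) := by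
    have h1 : Tendsto (fun s : ℝ => Δ / (2 * s) - ε * s / Δ) (𝓝[>] 0) atTop := by
      simpa [sub_eq_add_neg] using hdiv0.atTop_add hlin0.neg
    have h2 : Tendsto (fun s : ℝ => -(Δ / (2 * s)) - ε * s / Δ) (𝓝[>] 0) atBot := by
      simpa [sub_eq_add_neg] using (tendsto_neg_atTop_atBot.comp hdiv0).atBot_add hlin0.neg
    simpa using (htop.comp h1).sub ((hbot.comp h2).const_mul (Real.exp ε))
  have hne : S.Nonempty := by
    have h1 : Tendsto (fun s : ℝ => Δ / (2 * s) - ε * s / Δ) atTop atBot := by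
      have e1 : Tendsto (fun s : ℝ => Δ / (2 * s)) atTop (𝓝 0) :=
        (tendsto_id.const_mul_atTop two_pos).const_div_atTop Δ
      have e2 : Tendsto (fun s : ℝ => -(ε * s / Δ)) atTop atBot :=
        tendsto_neg_atTop_atBot.comp
          ((tendsto_id.const_mul_atTop hε).atTop_div_const hΔ)
      simpa [sub_eq_add_neg] using e1.add_atBot e2
    have h2 : ∀ᶠ s in atTop, stdNormalCDF (Δ / (2 * s) - ε * s / Δ) < δ :=
      (hbot.comp h1).eventually (gt_mem_nhds hδ.1)
    obtain ⟨s, hs, hs0⟩ := (h2.and (eventually_gt_atTop 0)).exists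
    refine ⟨s, hs0, ?_⟩
    have : 0 ≤ Real.exp ε * stdNormalCDF (-(Δ / (2 * s)) - ε * s / Δ) :=
      mul_nonneg (Real.exp_pos _).le (cdf_nonneg _ _)
    simp only [hh]
    linarith
  have hpos : 0 < sInf S := by
    have h1 : ∀ᶠ s in 𝓝[>] (0 : ℝ), δ < h s := hzero.eventually (lt_mem_nhds hδ.2)
    obtain ⟨u, hu, hu'⟩ := mem_nhdsGT_iff_exists_Ioo_subset.mp h1
    refine lt_of_lt_of_le hu (le_csInf hne fun s hs => ?_)
    by_contra hsu
    exact absurd hs.2 (not_le.mpr (hu' ⟨hs.1, not_le.mp hsu⟩))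
  refine hdef ▸ ⟨hpos, ?_⟩
  have hcont : ContinuousAt h (sInf S) := by
    have hd : ContinuousAt (fun s : ℝ => Δ / (2 * s)) (sInf S) :=
      continuousAt_const.div (by fun_prop) (by positivity)
    have hl : ContinuousAt (fun s : ℝ => ε * s / Δ) (sInf S) := by fun_prop
    exact (continuous_stdNormalCDF.continuousAt.comp (hd.sub hl)).sub
      (continuousAt_const.mul (continuous_stdNormalCDF.continuousAt.comp (hd.neg.sub hl)))
  obtain ⟨u, -, hu, huS⟩ := exists_seq_tendsto_sInf hne hbdd
  exact le_of_tendsto (hcont.tendsto.comp hu) (Eventually.of_forall fun n => (huS n).2)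

end PrivacyLoss

/-! ### Sensitivity of the sufficient statistics -/

section Sensitivity

variable {p d n : ℕ} {Ry : ℝ}

/-- Any `d` values of an antitone function on two copies of `ℕ` sum to at most its values on the
first `d / 2 + 1` places of both copies. -/
lemma sum_le_two_mul_sum_range {g : ℕ → ℝ} (hg : Antitone g) (hg0 : ∀ m, 0 ≤ g m)
    (S : Finset (ℕ × Bool)) :
    ∑ q ∈ S, g q.1 ≤ ∑ m ∈ Finset.range (S.card / 2 + 1), 2 * g m := by
  classical
  set T : Finset (ℕ × Bool) := Finset.range (S.card / 2 + 1) ×ˢ Finset.univ with hT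
  have hTcard : S.card ≤ T.card := by
    rw [hT, Finset.card_product, Finset.card_range, Finset.card_univ, Fintype.card_bool]
    omega
  have hTsum : ∑ q ∈ T, g q.1 = ∑ m ∈ Finset.range (S.card / 2 + 1), 2 * g m := by
    rw [hT, Finset.sum_product]
    simp
  have hdiff : (S \ T).card ≤ (T \ S).card := by
    have h1 := Finset.card_sdiff_add_card_inter S T
    have h2 := Finset.card_sdiff_add_card_inter T S
    rw [Finset.inter_comm] at h2
    omega
  have hST : ∑ q ∈ S \ T, g q.1 ≤ (S \ T).card * g (S.card / 2) := by
    rw [← nsmul_eq_mul]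
    refine Finset.sum_le_card_nsmul _ _ _ fun q hq => hg ?_
    simp only [hT, Finset.mem_sdiff, Finset.mem_product, Finset.mem_range, Finset.mem_univ,
      and_true, not_lt] at hq
    omega
  have hTS : (T \ S).card * g (S.card / 2) ≤ ∑ q ∈ T \ S, g q.1 := by
    rw [← nsmul_eq_mul]
    refine Finset.card_nsmul_le_sum _ _ _ fun q hq => hg ?_
    simp only [hT, Finset.mem_sdiff, Finset.mem_product, Finset.mem_range, Finset.mem_univ,
      and_true] at hq
    omega
  rw [← hTsum, ← Finset.sum_inter_add_sum_sdiff S T, ← Finset.sum_inter_add_sum_sdiff T S,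
    Finset.inter_comm T S]
  have : ((S \ T).card : ℝ) * g (S.card / 2) ≤ (T \ S).card * g (S.card / 2) :=
    mul_le_mul_of_nonneg_right (by exact_mod_cast hdiff) (hg0 _)
  linarith

lemma kernelNorm_le_of_stationary {k : Input p → Input p → ℝ} {Z : Fin d → Input p} {σf : ℝ}
    {kr : ℝ → ℝ} (hk : IsDecreasingStationary k σf kr) {x : Input p} {s : ℝ}
    (h : ∑ j, kr ‖Z j - x‖ ^ 2 ≤ s) : kernelNorm k Z x ≤ σf ^ 2 * Real.sqrt s := by
  have : ∑ j, k (Z j) x ^ 2 = (σf ^ 2) ^ 2 * ∑ j, kr ‖Z j - x‖ ^ 2 := by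
    rw [Finset.mul_sum]
    exact Finset.sum_congr rfl fun j _ => by rw [hk.eq, mul_pow]
  rw [kernelNorm, this, Real.sqrt_mul (by positivity), Real.sqrt_sq (by positivity)]
  gcongr

lemma IsDecreasingStationary.sq_le {k : Input p → Input p → ℝ} {σf : ℝ} {kr : ℝ → ℝ}
    (hk : IsDecreasingStationary k σf kr) {r s : ℝ} (hr : 0 ≤ r) (hrs : r ≤ s) :
    kr s ^ 2 ≤ kr r ^ 2 :=
  pow_le_pow_left₀ (hk.nonneg s (hr.trans hrs)) (hk.anti hr (hr.trans hrs) hrs) 2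

/-- In dimension one, the points on either side of `x` fall into different cells of length `dz`. -/
lemma sum_sq_le_of_oneDim {k : Input 1 → Input 1 → ℝ} {Z : Fin d → Input 1} {σf dz : ℝ}
    {kr : ℝ → ℝ} (hk : IsDecreasingStationary k σf kr) (hdz : 0 < dz)
    (hZ : ∀ i j, i ≠ j → dz ≤ ‖Z i - Z j‖) (x : Input 1) :
    ∑ j, kr ‖Z j - x‖ ^ 2 ≤ ∑ j ∈ Finset.range (d / 2 + 1), 2 * kr (j * dz) ^ 2 := by
  classical
  have hnorm : ∀ v : Input 1, ‖v‖ = |v 0| := fun v => by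
    rw [EuclideanSpace.norm_eq]; simp [Real.sqrt_sq_eq_abs]
  let cell : Fin d → ℕ × Bool := fun j => (⌊‖Z j - x‖ / dz⌋₊, decide (x 0 ≤ Z j 0))
  have hcell : ∀ j, ((cell j).1 : ℝ) * dz ≤ ‖Z j - x‖ := fun j =>
    (le_div_iff₀ hdz).mp (Nat.floor_le (by positivity))
  have hcell' : ∀ j, ‖Z j - x‖ < ((cell j).1 + 1) * dz := fun j =>
    (div_lt_iff₀ hdz).mp (Nat.lt_floor_add_one _)
  have hinj : Function.Injective cell := by
    intro i j hij
    by_contra hne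
    have hd := hZ i j hne
    have h1 := hcell i
    have h2 := hcell' i
    have h3 := hcell j
    have h4 := hcell' j
    rw [hij] at h1 h2
    have hs : (x 0 ≤ Z i 0 ↔ x 0 ≤ Z j 0) := by
      have := congrArg Prod.snd hij
      simpa [cell] using this
    rw [hnorm] at hd h1 h2 h3 h4
    simp only [PiLp.sub_apply] at hd h1 h2 h3 h4
    by_cases hx : x 0 ≤ Z i 0
    · have hx' := hs.mp hx
      rw [abs_of_nonneg (sub_nonneg.mpr hx)] at h1 h2
      rw [abs_of_nonneg (sub_nonneg.mpr hx')] at h3 h4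
      rcases le_abs.mp hd with h | h <;> linarith
    · have hx' : Z j 0 < x 0 := not_le.mp fun h => hx (hs.mpr h)
      rw [not_le] at hx
      rw [abs_of_nonpos (by linarith)] at h1 h2
      rw [abs_of_nonpos (by linarith)] at h3 h4
      rcases le_abs.mp hd with h | h <;> linarith
  let g : ℕ → ℝ := fun m => kr (m * dz) ^ 2
  have hganti : Antitone g := fun m m' hm => hk.sq_le (by positivity) (by gcongr)
  calc ∑ j, kr ‖Z j - x‖ ^ 2 ≤ ∑ j, g (cell j).1 :=
        Finset.sum_le_sum fun j _ => hk.sq_le (by positivity) (hcell j)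
    _ = ∑ q ∈ Finset.univ.image cell, g q.1 := by
        rw [Finset.sum_image fun i _ j _ h => hinj h]
    _ ≤ _ := by
        have := sum_le_two_mul_sum_range hganti (fun m => sq_nonneg _) (Finset.univ.image cell)
        rwa [Finset.card_image_of_injective _ hinj, Finset.card_univ, Fintype.card_fin] at this

/-- At most one of the points is closer than `dz / 2` to `x`. -/
lemma sum_sq_le_of_separated {k : Input p → Input p → ℝ} {Z : Fin d → Input p} {σf dz : ℝ}
    {kr : ℝ → ℝ} (hk : IsDecreasingStationary k σf kr) (hdz : 0 < dz)
    (hZ : ∀ i j, i ≠ j → dz ≤ ‖Z i - Z j‖) (x : Input p) :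
    ∑ j, kr ‖Z j - x‖ ^ 2 ≤ 1 + ((d : ℝ) - 1) * kr (dz / 2) ^ 2 := by
  have hone : ∀ r, 0 ≤ r → kr r ^ 2 ≤ 1 := fun r hr =>
    pow_le_one₀ (hk.nonneg r hr) (hk.le_one r hr)
  by_cases hfar : ∀ j, dz / 2 ≤ ‖Z j - x‖
  · have h1 : ∑ j, kr ‖Z j - x‖ ^ 2 ≤ ∑ _j : Fin d, kr (dz / 2) ^ 2 :=
      Finset.sum_le_sum fun j _ => hk.sq_le (by positivity) (hfar j)
    rw [Finset.sum_const, Finset.card_univ, Fintype.card_fin, nsmul_eq_mul] at h1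
    linarith [hone (dz / 2) (by positivity)]
  · push Not at hfar
    obtain ⟨i, hi⟩ := hfar
    have hother : ∀ j ∈ Finset.univ.erase i, kr ‖Z j - x‖ ^ 2 ≤ kr (dz / 2) ^ 2 := by
      intro j hj
      refine hk.sq_le (by positivity) ?_
      have h1 := hZ j i (Finset.ne_of_mem_erase hj)
      have h2 := norm_sub_le_norm_sub_add_norm_sub (Z j) x (Z i)
      rw [norm_sub_rev x (Z i)] at h2
      linarith
    have h1 := Finset.sum_le_card_nsmul _ _ _ hother
    rw [Finset.card_erase_of_mem (Finset.mem_univ _), Finset.card_univ, Fintype.card_fin,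
      nsmul_eq_mul, Nat.cast_sub (Fin.pos i), Nat.cast_one] at h1
    rw [← Finset.add_sum_erase _ _ (Finset.mem_univ i)]
    linarith [hone ‖Z i - x‖ (by positivity)]

lemma kernelNorm_le {k : Input p → Input p → ℝ} {Z : Fin d → Input p} {R : ℝ}
    (h : IsKernelBound k Z R) (x : Input p) : kernelNorm k Z x ≤ R := by
  cases h with
  | basic σf hk =>
    have h1 : ∑ j, k (Z j) x ^ 2 ≤ ∑ _j : Fin d, (σf ^ 2) ^ 2 :=
      Finset.sum_le_sum fun j _ => sq_le_sq' (abs_le.mp (hk _ _)).1 (abs_le.mp (hk _ _)).2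
    rw [Finset.sum_const, Finset.card_univ, Fintype.card_fin, nsmul_eq_mul] at h1
    rw [kernelNorm, ← Real.sqrt_sq (sq_nonneg σf), ← Real.sqrt_mul (by positivity)]
    exact Real.sqrt_le_sqrt h1
  | oneDim hp σf dz kr hk hdz hZ =>
    subst hp
    refine kernelNorm_le_of_stationary hk ((sum_sq_le_of_oneDim hk hdz hZ x).trans ?_)
    have : ((d / 2 : ℕ) : ℝ) ≤ (((d + 1) / 2 : ℕ) : ℝ) := by
      exact_mod_cast Nat.div_le_div_right (Nat.le_succ d)
    exact le_add_of_nonneg_right (mul_nonneg (sub_nonneg.mpr this) (sq_nonneg _))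
  | multiDim σf dz kr hk hdz hZ =>
    exact kernelNorm_le_of_stationary hk (sum_sq_le_of_separated hk hdz hZ x)
  | direct R hR => exact hR x

/-- The scaling of the off-diagonal entries makes `upperVec` an isometry for the Frobenius norm. -/
lemma sum_upperVec_sq {M : Matrix (Fin d) (Fin d) ℝ} (hM : ∀ a b, M a b = M b a) :
    ∑ q, upperVec M q ^ 2 = ∑ a, ∑ b, M a b ^ 2 := by
  have h1 : ∑ q : UpperIdx d, upperVec M q ^ 2 = ∑ q : Fin d × Fin d,
      (if q.1 ≤ q.2 then (if q.1 = q.2 then M q.1 q.2 ^ 2 else 2 * M q.1 q.2 ^ 2) else 0) := by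
    rw [← Finset.sum_filter, ← Finset.sum_subtype_eq_sum_filter, Finset.subtype_univ]
    refine Finset.sum_congr rfl fun q _ => ?_
    rw [upperVec]
    split_ifs
    · rfl
    · rw [mul_pow, Real.sq_sqrt zero_le_two]
  have h2 : ∑ q : Fin d × Fin d, (if q.1 < q.2 then M q.1 q.2 ^ 2 else 0)
      = ∑ q : Fin d × Fin d, (if q.2 < q.1 then M q.1 q.2 ^ 2 else 0) := by
    rw [← (Equiv.prodComm (Fin d) (Fin d)).sum_comp]
    refine Finset.sum_congr rfl fun q _ => ?_
    simp only [Equiv.prodComm_apply, Prod.fst_swap, Prod.snd_swap, hM q.2 q.1]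
  rw [h1, ← Fintype.sum_prod_type']
  have h3 : ∑ q : Fin d × Fin d,
        (if q.1 ≤ q.2 then (if q.1 = q.2 then M q.1 q.2 ^ 2 else 2 * M q.1 q.2 ^ 2) else 0)
      = ∑ q : Fin d × Fin d, (if q.1 = q.2 then M q.1 q.2 ^ 2 else 0)
        + (∑ q : Fin d × Fin d, (if q.1 < q.2 then M q.1 q.2 ^ 2 else 0)
        + ∑ q : Fin d × Fin d, (if q.1 < q.2 then M q.1 q.2 ^ 2 else 0)) := by
    rw [← Finset.sum_add_distrib, ← Finset.sum_add_distrib]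
    refine Finset.sum_congr rfl fun q _ => ?_
    rcases lt_trichotomy q.1 q.2 with h | h | h
    · simp [h.le, h.ne, h, two_mul]
    · simp [h]
    · simp [h.not_ge, h.ne', h.not_gt]
  have h4 : ∑ q : Fin d × Fin d, (if q.1 = q.2 then M q.1 q.2 ^ 2 else 0)
        + (∑ q : Fin d × Fin d, (if q.1 < q.2 then M q.1 q.2 ^ 2 else 0)
        + ∑ q : Fin d × Fin d, (if q.2 < q.1 then M q.1 q.2 ^ 2 else 0))
      = ∑ q : Fin d × Fin d, M q.1 q.2 ^ 2 := by
    rw [← Finset.sum_add_distrib, ← Finset.sum_add_distrib]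
    refine Finset.sum_congr rfl fun q _ => ?_
    rcases lt_trichotomy q.1 q.2 with h | h | h
    · simp [h.ne, h, h.not_gt]
    · simp [h]
    · simp [h, h.ne', h.not_gt]
  linarith

/-- Combined change of `y k` and `c k kᵀ` when an entry is replaced; the inner product `t = ⟨k, k'⟩`
enters as `-2 y y' t - 2 c² t²`, which is at most `(y y')² / (2 c²)`. -/
lemma sum_sq_sub_le {u u' : Fin d → ℝ} {y y' R c : ℝ} (hc : 0 < c) (hy : y ^ 2 ≤ Ry ^ 2)
    (hy' : y' ^ 2 ≤ Ry ^ 2) (hu : ∑ a, u a ^ 2 ≤ R ^ 2) (hu' : ∑ a, u' a ^ 2 ≤ R ^ 2) :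
    ∑ a, (u a * y - u' a * y') ^ 2 + c ^ 2 * ∑ a, ∑ b, (u a * u b - u' a * u' b) ^ 2 ≤
      Ry ^ 4 / (2 * c ^ 2) + 2 * Ry ^ 2 * R ^ 2 + 2 * c ^ 2 * R ^ 4 := by
  set U := ∑ a, u a ^ 2 with hU
  set U' := ∑ a, u' a ^ 2 with hU'
  set t := ∑ a, u a * u' a with ht
  have hU0 : 0 ≤ U := Finset.sum_nonneg fun a _ => sq_nonneg _
  have hU0' : 0 ≤ U' := Finset.sum_nonneg fun a _ => sq_nonneg _
  have e1 : ∑ a, (u a * y - u' a * y') ^ 2 = y ^ 2 * U + y' ^ 2 * U' - 2 * (y * y') * t := by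
    rw [hU, hU', ht, Finset.mul_sum, Finset.mul_sum, Finset.mul_sum, ← Finset.sum_add_distrib,
      ← Finset.sum_sub_distrib]
    exact Finset.sum_congr rfl fun a _ => by ring
  have e2 : ∑ a, ∑ b, (u a * u b - u' a * u' b) ^ 2 = U ^ 2 + U' ^ 2 - 2 * t ^ 2 := by
    rw [hU, hU', ht, sq (∑ a, u a ^ 2), sq (∑ a, u' a ^ 2), sq (∑ a, u a * u' a),
      Finset.sum_mul_sum, Finset.sum_mul_sum, Finset.sum_mul_sum, Finset.mul_sum,
      ← Finset.sum_add_distrib, ← Finset.sum_sub_distrib]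
    refine Finset.sum_congr rfl fun a _ => ?_
    rw [Finset.mul_sum, ← Finset.sum_add_distrib, ← Finset.sum_sub_distrib]
    exact Finset.sum_congr rfl fun b _ => by ring
  rw [e1, e2]
  have i1 : y ^ 2 * U ≤ Ry ^ 2 * R ^ 2 := by gcongr
  have i2 : y' ^ 2 * U' ≤ Ry ^ 2 * R ^ 2 := by gcongr
  have i3 : U ^ 2 ≤ R ^ 4 := by
    calc U ^ 2 ≤ (R ^ 2) ^ 2 := by gcongr
      _ = R ^ 4 := by ring
  have i4 : U' ^ 2 ≤ R ^ 4 := by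
    calc U' ^ 2 ≤ (R ^ 2) ^ 2 := by gcongr
      _ = R ^ 4 := by ring
  have i5 : -2 * (y * y') * t - 2 * c ^ 2 * t ^ 2 ≤ Ry ^ 4 / (2 * c ^ 2) := by
    rw [le_div_iff₀ (by positivity)]
    have : y ^ 2 * y' ^ 2 ≤ Ry ^ 2 * Ry ^ 2 := by gcongr
    nlinarith [sq_nonneg (y * y' + 2 * c ^ 2 * t)]
  have i6 : c ^ 2 * U ^ 2 ≤ c ^ 2 * R ^ 4 := by gcongr
  have i7 : c ^ 2 * U' ^ 2 ≤ c ^ 2 * R ^ 4 := by gcongr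
  linarith

lemma sum_sq_sub_le_sensitivity {k : Input p → Input p → ℝ} {Z : Fin d → Input p} {R c : ℝ}
    (hR : IsKernelBound k Z R) (hc : 0 < c) {D D' : Fin n → Entry p Ry}
    (h : SubstNeighbour D D') :
    ∑ a, (matA k Z D a - matA k Z D' a) ^ 2
      + c ^ 2 * ∑ q, (upperVec (matB k Z D) q - upperVec (matB k Z D') q) ^ 2
      ≤ sensitivity Ry R c ^ 2 := by
  obtain ⟨j, hj⟩ := h
  have hsub : ∀ f : Entry p Ry → ℝ, ∑ i, f (D i) - ∑ i, f (D' i) = f (D j) - f (D' j) := by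
    intro f
    rw [← Finset.sum_sub_distrib]
    refine Finset.sum_eq_single_of_mem j (Finset.mem_univ _) fun i _ hi => ?_
    rw [hj i hi, sub_self]
  have hA : ∀ a, matA k Z D a - matA k Z D' a
      = k (Z a) (D j).1 * (D j).2 - k (Z a) (D' j).1 * (D' j).2 := fun a =>
    hsub fun e => k (Z a) e.1 * (e.2 : ℝ)
  have hB : ∀ a b, (matB k Z D - matB k Z D') a b
      = k (Z a) (D j).1 * k (Z b) (D j).1 - k (Z a) (D' j).1 * k (Z b) (D' j).1 := fun a b =>
    hsub fun e => k (Z a) e.1 * k (Z b) e.1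
  have hvec : ∀ q, upperVec (matB k Z D) q - upperVec (matB k Z D') q
      = upperVec (matB k Z D - matB k Z D') q := by
    intro q
    simp only [upperVec, Matrix.sub_apply]
    split_ifs <;> ring
  have hnorm : ∀ x, ∑ a, k (Z a) x ^ 2 ≤ R ^ 2 := fun x =>
    (Real.sqrt_le_iff.mp (kernelNorm_le hR x)).2
  have hy : ∀ e : Entry p Ry, (e.2 : ℝ) ^ 2 ≤ Ry ^ 2 := fun e => sq_le_sq' e.2.2.1 e.2.2.2
  simp_rw [hvec]
  rw [sum_upperVec_sq (fun a b => by rw [hB, hB]; ring)]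
  simp_rw [hA, hB]
  rw [sensitivity, Real.sq_sqrt (by positivity)]
  exact sum_sq_sub_le hc (hy _) (hy _) (hnorm _) (hnorm _)

end Sensitivity

/-! ### Measurability of the update and of the score -/

section Measurability

variable {T : Type*} [MeasurableSpace T] {m n l : Type*} [Fintype n]

/-- Entrywise measurability of a matrix depending on a parameter. -/
def MeasurableEntries (f : T → Matrix m l ℝ) : Prop := ∀ i j, Measurable fun t => f t i j

lemma MeasurableEntries.const (M : Matrix m l ℝ) : MeasurableEntries fun _ : T => M :=
  fun _ _ => measurable_const

lemma MeasurableEntries.add {f h : T → Matrix m l ℝ} (hf : MeasurableEntries f)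
    (hh : MeasurableEntries h) : MeasurableEntries fun t => f t + h t :=
  fun i j => (hf i j).add (hh i j)

lemma MeasurableEntries.sub {f h : T → Matrix m l ℝ} (hf : MeasurableEntries f)
    (hh : MeasurableEntries h) : MeasurableEntries fun t => f t - h t :=
  fun i j => (hf i j).sub (hh i j)

lemma MeasurableEntries.smul {f : T → Matrix m l ℝ} (hf : MeasurableEntries f) (c : ℝ) :
    MeasurableEntries fun t => c • f t :=
  fun i j => (hf i j).const_smul c

lemma MeasurableEntries.sum {ι : Type*} (s : Finset ι) {f : ι → T → Matrix m l ℝ}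
    (hf : ∀ a ∈ s, MeasurableEntries (f a)) : MeasurableEntries fun t => ∑ a ∈ s, f a t := by
  intro i j
  simp_rw [Matrix.sum_apply]
  exact Finset.measurable_sum _ fun a ha => hf a ha i j

lemma MeasurableEntries.mul {f : T → Matrix m n ℝ} {h : T → Matrix n l ℝ}
    (hf : MeasurableEntries f) (hh : MeasurableEntries h) :
    MeasurableEntries fun t => f t * h t := by
  intro i j
  simp_rw [Matrix.mul_apply]
  exact Finset.measurable_sum _ fun a _ => (hf i a).mul (hh a j)

lemma MeasurableEntries.mulVec {f : T → Matrix m n ℝ} {v : T → n → ℝ} (hf : MeasurableEntries f)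
    (hv : ∀ a, Measurable fun t => v t a) (i : m) :
    Measurable fun t => (f t).mulVec (v t) i := by
  simp_rw [Matrix.mulVec, dotProduct]
  exact Finset.measurable_sum _ fun a _ => (hf i a).mul (hv a)

lemma MeasurableEntries.inv [DecidableEq n] {f : T → Matrix n n ℝ} (hf : MeasurableEntries f) :
    MeasurableEntries fun t => (f t)⁻¹ := by
  have hdet : ∀ {h : T → Matrix n n ℝ}, MeasurableEntries h → Measurable fun t => (h t).det := by
    intro h hh
    simp_rw [Matrix.det_apply]
    exact Finset.measurable_sum _ fun σ _ => Measurable.const_smul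
      (Finset.measurable_prod _ fun i _ => hh _ _) _
  intro i j
  simp_rw [Matrix.inv_def, Matrix.smul_apply, Matrix.adjugate_apply, Ring.inverse_eq_inv',
    smul_eq_mul]
  refine (hdet hf).inv.mul (hdet fun a b => ?_)
  by_cases ha : a = j
  · subst ha
    simp
  · simpa [Matrix.updateRow_ne ha] using hf a b

variable {p d : ℕ} {Ry : ℝ}

lemma measurable_posterior (k : Input p → Input p → ℝ) (Z : Fin d → Input p) (σ σa σb ρ : ℝ) :
    Measurable (posterior k Z σ σa σb ρ) := by
  have hB : MeasurableEntries fun w : (Fin d → ℝ) × (UpperIdx d → ℝ) => symOfUpper w.2 := by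
    intro i j
    simp only [symOfUpper, Matrix.of_apply]
    have h : ∀ q : UpperIdx d, Measurable fun w : (Fin d → ℝ) × (UpperIdx d → ℝ) => w.2 q :=
      fun q => (measurable_pi_apply q).comp measurable_snd
    split_ifs
    · exact h _
    · exact (h _).div_const _
  have ha : ∀ i, Measurable fun w : (Fin d → ℝ) × (UpperIdx d → ℝ) => w.1 i :=
    fun i => (measurable_pi_apply i).comp measurable_fst
  have hK : MeasurableEntries fun _ : (Fin d → ℝ) × (UpperIdx d → ℝ) => gram k Z := .const _
  have hS : MeasurableEntries fun w : (Fin d → ℝ) × (UpperIdx d → ℝ) =>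
      sigmaTilde (gram k Z) (symOfUpper w.2) σ (regLambda d σ σb ρ) :=
    ((hK.add (hB.smul _)).add (.const _)).inv
  have haa : MeasurableEntries fun w : (Fin d → ℝ) × (UpperIdx d → ℝ) =>
      Matrix.vecMulVec w.1 w.1 := fun i j => (ha i).mul (ha j)
  have hE : ∀ i j : Fin d, MeasurableEntries fun _ : (Fin d → ℝ) × (UpperIdx d → ℝ) =>
      (Matrix.single i j 1 : Matrix (Fin d) (Fin d) ℝ) := fun i j => .const _
  have hAt := (hS.mul haa).mul hS
  have hP : ∀ i j i' j', MeasurableEntries fun w : (Fin d → ℝ) × (UpperIdx d → ℝ) =>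
      gram k Z * sigmaTilde (gram k Z) (symOfUpper w.2) σ (regLambda d σ σb ρ)
        * (Matrix.single i j 1 : Matrix (Fin d) (Fin d) ℝ)
        * (sigmaTilde (gram k Z) (symOfUpper w.2) σ (regLambda d σ σb ρ)
          * Matrix.vecMulVec w.1 w.1
          * sigmaTilde (gram k Z) (symOfUpper w.2) σ (regLambda d σ σb ρ))
        * (Matrix.single i' j' 1 : Matrix (Fin d) (Fin d) ℝ)
        * sigmaTilde (gram k Z) (symOfUpper w.2) σ (regLambda d σ σb ρ) * gram k Z :=
    fun i j i' j' => (((((hK.mul hS).mul (hE i j)).mul hAt).mul (hE i' j')).mul hS).mul hK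
  refine Measurable.prodMk (measurable_pi_iff.mpr fun i => ?_)
    (measurable_pi_iff.mpr fun i => measurable_pi_iff.mpr fun j => ?_)
  · exact ((hK.mul hS).mulVec ha i).const_smul _
  · refine ((((hK.mul hS).mul hK).add ((((hK.mul (hS.mul hS)).mul hK).smul _).add
      (MeasurableEntries.add (.sum _ fun i _ => ?_)
        (.sum _ fun i _ => .sum _ fun j _ => ?_)))) i j :)
    · exact (hP i i i i).smul _
    · exact ((hP i j j i).add (hP j i i j)).smul _

lemma measurable_valLogLik (θ : Candidate p) (Z : Fin d → Input p) (e : Entry p Ry) :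
    Measurable fun M : Model d => valLogLik θ Z M e := by
  have h1 : ∀ a, Measurable fun M : Model d => M.1 a :=
    fun a => (measurable_pi_apply a).comp measurable_fst
  have h2 : MeasurableEntries fun M : Model d => Matrix.of M.2 := fun i j =>
    (measurable_pi_apply j).comp ((measurable_pi_apply i).comp measurable_snd)
  have hmean : Measurable fun M : Model d => predMean θ.kernel Z M e.1 := by
    unfold predMean dotProduct
    exact Finset.measurable_sum _ fun a _ =>
      ((MeasurableEntries.const (gram θ.kernel Z)⁻¹).mulVec h1 a).const_mul _
  have hvar : Measurable fun M : Model d => predVar θ.kernel Z M e.1 := by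
    unfold predVar dotProduct
    refine measurable_const.sub (Finset.measurable_sum _ fun a _ => Measurable.const_mul
      (MeasurableEntries.mulVec (v := fun _ a => θ.kernel (Z a) e.1) ?_
        (fun _ => measurable_const) a) _)
    exact ((MeasurableEntries.const _).mul ((MeasurableEntries.const _).sub h2)).mul (.const _)
  unfold valLogLik logNormalDensity
  fun_prop

variable {n₂ : ℕ}

lemma measurable_score (Z : Fin d → Input p) (θ : Candidate p) (β ε δ : ℝ)
    (D : Fin n₂ → Entry p Ry) : Measurable fun M : Model d => score Z θ β ε δ M D := by
  unfold score coinPressMean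
  refine (Measure.measurable_map _ (measurable_const_mul _)).comp ?_
  exact measurable_coinPressIter _ (fun j => measurable_clip measurable_const measurable_const
    (measurable_valLogLik θ Z (D j))) measurable_const _

lemma isProbabilityMeasure_score (Z : Fin d → Input p) (θ : Candidate p) (β ε δ : ℝ)
    (M : Model d) (D : Fin n₂ → Entry p Ry) : IsProbabilityMeasure (score Z θ β ε δ M D) := by
  unfold score coinPressMean
  have := isProbabilityMeasure_coinPressIter
    (fun j => clip (centreCP Ry θ.noise) (radiusCP Ry θ.noise) (valLogLik θ Z M (D j)))
    (coinPressSchedule (zcdpBudget ε δ) β) (centreCP Ry θ.noise) (radiusCP Ry θ.noise)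
  exact Measure.isProbabilityMeasure_map (measurable_const_mul _).aemeasurable

lemma close_score (Z : Fin d → Input p) (θ : Candidate p) {β ε δ : ℝ} (hβ : 0 < β ∧ β < 1)
    (hε : 0 < ε) (hδ : 0 < δ ∧ δ < 1) (M : Model d) {D D' : Fin n₂ → Entry p Ry}
    (h : SubstNeighbour D D') :
    Close (score Z θ β ε δ M D) (score Z θ β ε δ M D')
      (ENNReal.ofReal (Real.exp ε)) (ENNReal.ofReal δ) := by
  obtain ⟨j, hj⟩ := h
  refine (close_coinPressMean ⟨j, fun i hi => ?_⟩ _ ?_ hβ hε hδ).map (measurable_const_mul _)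
  · simp only [hj i hi]
  · unfold radiusCP
    positivity

end Measurability

/-! ### Privacy of one draw -/

section Draw

variable {p d K n₁ n₂ : ℕ} {Ry : ℝ}

instance isProbabilityMeasure_noisySums (k : Input p → Input p → ℝ) (Z : Fin d → Input p)
    (σa σb : ℝ) (D : Fin n₁ → Entry p Ry) : IsProbabilityMeasure (noisySums k Z σa σb D) := by
  unfold noisySums; infer_instance

instance isProbabilityMeasure_inference (Z : Fin d → Input p) (θ : Candidate p) (c ρ ε δ : ℝ)
    (D : Fin n₁ → Entry p Ry) : IsProbabilityMeasure (inference Z θ c ρ ε δ D) :=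
  Measure.isProbabilityMeasure_map (measurable_posterior _ _ _ _ _ _).aemeasurable

lemma close_inference (hRy : 0 < Ry) {Z : Fin d → Input p} {θ : Candidate p}
    (hθ : IsKernelBound θ.kernel Z θ.kernelBound) {c : ℝ} (hc : 0 < c) (ρ : ℝ) {ε δ : ℝ}
    (hε : 0 < ε) (hδ : 0 < δ ∧ δ < 1) {D D' : Fin n₁ → Entry p Ry} (h : SubstNeighbour D D') :
    Close (inference Z θ c ρ ε δ D) (inference Z θ c ρ ε δ D')
      (ENNReal.ofReal (Real.exp ε)) (ENNReal.ofReal δ) := by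
  set Δ := sensitivity Ry θ.kernelBound c with hΔ
  have hΔpos : 0 < Δ := by
    rw [hΔ, sensitivity]
    exact Real.sqrt_pos.mpr (by positivity)
  obtain ⟨hσ, hσδ⟩ := analyticGaussianSigma_spec hΔpos hε hδ
  set σ := analyticGaussianSigma Δ ε δ with hσdef
  have hva : ((σ ^ 2).toNNReal : ℝ) = σ ^ 2 := Real.coe_toNNReal _ (by positivity)
  have hvb : (((σ / c) ^ 2).toNNReal : ℝ) = (σ / c) ^ 2 := Real.coe_toNNReal _ (by positivity)
  have hva0 : (σ ^ 2).toNNReal ≠ 0 := by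
    have : 0 < σ ^ 2 := by positivity
    simpa using this.ne'
  have hvb0 : ((σ / c) ^ 2).toNNReal ≠ 0 := by
    have : 0 < (σ / c) ^ 2 := by positivity
    intro h0
    rw [h0] at hvb
    exact this.ne hvb
  let ηa : NNReal := ⟨(∑ a, (matA θ.kernel Z D a - matA θ.kernel Z D' a) ^ 2)
    / (σ ^ 2).toNNReal, by positivity⟩
  let ηb : NNReal := ⟨(∑ q, (upperVec (matB θ.kernel Z D) q
    - upperVec (matB θ.kernel Z D') q) ^ 2) / ((σ / c) ^ 2).toNNReal, by positivity⟩
  have hloss : GaussianLoss (noisySums θ.kernel Z σ (σ / c) D)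
      (noisySums θ.kernel Z σ (σ / c) D') (ηa + ηb) :=
    (gaussianLoss_pi _ _ hva0 rfl).prod (gaussianLoss_pi _ _ hvb0 rfl)
  have hη : ((ηa + ηb : NNReal) : ℝ) ≤ (Δ / σ) ^ 2 := by
    have hs := sum_sq_sub_le_sensitivity (Ry := Ry) hθ hc h
    rw [← hΔ] at hs
    have e : ((ηa + ηb : NNReal) : ℝ) =
        (∑ a, (matA θ.kernel Z D a - matA θ.kernel Z D' a) ^ 2
          + c ^ 2 * ∑ q, (upperVec (matB θ.kernel Z D) q
            - upperVec (matB θ.kernel Z D') q) ^ 2) / σ ^ 2 := by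
      show _ / ((σ ^ 2).toNNReal : ℝ) + _ / (((σ / c) ^ 2).toNNReal : ℝ) = _
      rw [hva, hvb]
      field_simp
    rw [e, div_pow]
    gcongr
  refine (hloss.close_of_le (div_pos hΔpos hσ) hη ?_).map (measurable_posterior _ _ _ _ _ _)
  have e1 : Δ / σ / 2 = Δ / (2 * σ) := by rw [div_div, mul_comm]
  have e2 : ε / (Δ / σ) = ε * σ / Δ := by rw [div_div_eq_mul_div]
  rw [e1, e2]
  exact hσδ

lemma measurable_value : Measurable (State.value (d := d)) :=
  measurable_const.sumElim (measurable_coe_real_ereal.comp measurable_snd)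

lemma value_le_init_iff (q : State d) : State.value q ≤ State.value (Sum.inl () : State d)
    ↔ q = Sum.inl () := by
  rcases q with q | q
  · simp [State.value]
  · simp [State.value]

lemma measurable_update (ub : ℝ) (s : State d) :
    Measurable fun q : Model d × ℝ => State.update ub s q.1 q.2 := by
  unfold State.update
  refine Measurable.ite (MeasurableSet.inter (measurableSet_le measurable_snd measurable_const)
    (measurableSet_lt measurable_const (measurable_coe_real_ereal.comp measurable_snd)))
    (measurable_inr.comp measurable_id) measurable_const

lemma measurable_update_right (ub : ℝ) (s : State d) (M : Model d) :
    Measurable fun v => State.update ub s M v :=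
  (measurable_update ub s).comp measurable_prodMk_left

/-- Updating amounts to comparing with the state that the draw alone would produce. -/
lemma update_eq_keepBest (ub : ℝ) (s : State d) (M : Model d) (v : ℝ) :
    State.update ub s M v = keepBest State.value s (State.update ub (Sum.inl ()) M v) := by
  have hbot : State.value (Sum.inl () : State d) = ⊥ := rfl
  have hval : State.value (Sum.inr (M, v) : State d) = (v : EReal) := rfl
  unfold State.update keepBest
  by_cases h : v ≤ ub
  · by_cases h' : State.value s < (v : EReal)
    · simp [h, h', hbot, hval]
    · simp [h, h', hbot, hval]
  · simp [h, hbot]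

/-- Law of the state that one draw of candidate `i` produces from `s`. -/
def candidateLaw (A : Setup p d K) (ε δ : ℝ) (D₁ : Fin n₁ → Entry p Ry)
    (D₂ : Fin n₂ → Entry p Ry) (s : State d) (i : Fin K) : Measure (State d) :=
  (inference A.Z (A.cand i) A.ratio A.regFail ε δ D₁).bind fun M =>
    (score A.Z (A.cand i) A.meanFail ε δ M D₂).map fun v =>
      State.update (centreCP Ry (A.cand i).noise + radiusCP Ry (A.cand i).noise) s M v

lemma iteration_eq_sum (A : Setup p d K) (ε δ : ℝ) (D₁ : Fin n₁ → Entry p Ry)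
    (D₂ : Fin n₂ → Entry p Ry) (s : State d) :
    iteration A ε δ D₁ D₂ s = ∑ i, (K : ENNReal)⁻¹ • candidateLaw A ε δ D₁ D₂ s i := rfl

lemma measurable_map_update (A : Setup p d K) (ε δ : ℝ) (D₂ : Fin n₂ → Entry p Ry) (s : State d)
    (i : Fin K) : Measurable fun M =>
      (score A.Z (A.cand i) A.meanFail ε δ M D₂).map fun v =>
        State.update (centreCP Ry (A.cand i).noise + radiusCP Ry (A.cand i).noise) s M v := by
  have hu := measurable_update (d := d)
    (centreCP Ry (A.cand i).noise + radiusCP Ry (A.cand i).noise) s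
  have h : ∀ M : Model d, (score A.Z (A.cand i) A.meanFail ε δ M D₂).map (fun v =>
        State.update (centreCP Ry (A.cand i).noise + radiusCP Ry (A.cand i).noise) s M v)
      = (score A.Z (A.cand i) A.meanFail ε δ M D₂).bind fun v => Measure.dirac
        (State.update (centreCP Ry (A.cand i).noise + radiusCP Ry (A.cand i).noise) s M v) :=
    fun M => (Measure.bind_dirac_eq_map _ (measurable_update_right _ s M)).symm
  simp_rw [h]
  exact measurable_bind_param (measurable_score _ _ _ _ _ _)
    (fun M => isProbabilityMeasure_score _ _ _ _ _ _ _) (Measure.measurable_dirac.comp hu)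

lemma isProbabilityMeasure_candidateLaw (A : Setup p d K) (ε δ : ℝ) (D₁ : Fin n₁ → Entry p Ry)
    (D₂ : Fin n₂ → Entry p Ry) (s : State d) (i : Fin K) :
    IsProbabilityMeasure (candidateLaw A ε δ D₁ D₂ s i) := by
  refine isProbabilityMeasure_bind (measurable_map_update A ε δ D₂ s i).aemeasurable
    (Filter.Eventually.of_forall fun M => ?_)
  have := isProbabilityMeasure_score A.Z (A.cand i) A.meanFail ε δ M D₂
  exact Measure.isProbabilityMeasure_map
    (measurable_update_right _ s _).aemeasurable

lemma isProbabilityMeasure_iteration (hK : 0 < K) (A : Setup p d K) (ε δ : ℝ)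
    (D₁ : Fin n₁ → Entry p Ry) (D₂ : Fin n₂ → Entry p Ry) (s : State d) :
    IsProbabilityMeasure (iteration A ε δ D₁ D₂ s) := by
  have := isProbabilityMeasure_candidateLaw A ε δ D₁ D₂ s
  refine ⟨?_⟩
  rw [iteration_eq_sum]
  simp [ENNReal.mul_inv_cancel (Nat.cast_ne_zero.mpr hK.ne') (ENNReal.natCast_ne_top K)]

lemma iteration_eq_map (A : Setup p d K) (ε δ : ℝ) (D₁ : Fin n₁ → Entry p Ry)
    (D₂ : Fin n₂ → Entry p Ry) (s : State d) :
    iteration A ε δ D₁ D₂ s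
      = (iteration A ε δ D₁ D₂ (Sum.inl ())).map (keepBest State.value s) := by
  have hk := measurable_keepBest_right (measurable_value (d := d)) s
  have hcand : ∀ i, candidateLaw A ε δ D₁ D₂ s i
      = (candidateLaw A ε δ D₁ D₂ (Sum.inl ()) i).map (keepBest State.value s) := by
    intro i
    ext O hO
    rw [Measure.map_apply hk hO, candidateLaw, candidateLaw,
      Measure.bind_apply hO (measurable_map_update A ε δ D₂ s i).aemeasurable,
      Measure.bind_apply (hk hO) (measurable_map_update A ε δ D₂ _ i).aemeasurable]
    refine lintegral_congr fun M => ?_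
    rw [Measure.map_apply (measurable_update_right _ s M) hO,
      Measure.map_apply (measurable_update_right _ _ M) (hk hO)]
    congr 1
    ext v
    simp only [Set.mem_preimage]
    rw [update_eq_keepBest]
  ext O hO
  rw [Measure.map_apply hk hO, iteration_eq_sum, iteration_eq_sum]
  simp only [Measure.coe_finsetSum, Finset.sum_apply, Measure.smul_apply, hcand,
    Measure.map_apply hk hO]

lemma loop_eq_stopLoop (A : Setup p d K) (ε δ γ : ℝ) (D₁ : Fin n₁ → Entry p Ry)
    (D₂ : Fin n₂ → Entry p Ry) (N : ℕ) (s : State d) :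
    loop A ε δ γ D₁ D₂ N s = stopLoop State.value (iteration A ε δ D₁ D₂ (Sum.inl ()))
      (ENNReal.ofReal γ) (ENNReal.ofReal (1 - γ)) N s := by
  induction N generalizing s with
  | zero => rfl
  | succ N ih =>
    rw [loop, stopLoop, ← iteration_eq_map]
    simp_rw [ih]

/-- One draw with its score is private with respect to the combined data: replacing a training
entry affects inference only, and replacing a validation entry affects the score only. -/
lemma close_iteration (hK : 0 < K) (hRy : 0 < Ry) {A : Setup p d K}
    (hbound : ∀ i, IsKernelBound (A.cand i).kernel A.Z (A.cand i).kernelBound)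
    (hratio : 0 < A.ratio) (hmean : 0 < A.meanFail ∧ A.meanFail < 1) {ε δ : ℝ} (hε : 0 < ε)
    (hδ : 0 < δ ∧ δ < 1) {D D' : (Fin n₁ → Entry p Ry) × (Fin n₂ → Entry p Ry)}
    (h : CombinedNeighbour D D') (s : State d) :
    Close (iteration A ε δ D.1 D.2 s) (iteration A ε δ D'.1 D'.2 s)
      (ENNReal.ofReal (Real.exp ε)) (ENNReal.ofReal δ) := by
  have hcand : ∀ i, Close (candidateLaw A ε δ D.1 D.2 s i) (candidateLaw A ε δ D'.1 D'.2 s i)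
      (ENNReal.ofReal (Real.exp ε)) (ENNReal.ofReal δ) := by
    intro i
    rcases h with ⟨h1, h2⟩ | ⟨h1, h2⟩
    · rw [← h2]
      refine (close_inference hRy (hbound i) hratio _ hε hδ h1).bind
        (measurable_map_update A ε δ D.2 s i) fun M => ?_
      have := isProbabilityMeasure_score A.Z (A.cand i) A.meanFail ε δ M D.2
      exact Measure.isProbabilityMeasure_map
        (measurable_update_right _ s _).aemeasurable
    · rw [← h1]
      exact Close.bind_right (measurable_map_update A ε δ D.2 s i)
        (measurable_map_update A ε δ D'.2 s i) fun M =>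
          (close_score A.Z (A.cand i) hmean hε hδ M h2).map
            (measurable_update_right _ s M)
  intro O hO
  have hK1 : (K : ENNReal) * (K : ENNReal)⁻¹ = 1 :=
    ENNReal.mul_inv_cancel (Nat.cast_ne_zero.mpr hK.ne') (ENNReal.natCast_ne_top K)
  simp only [iteration_eq_sum, Measure.coe_finsetSum, Finset.sum_apply, Measure.smul_apply,
    smul_eq_mul]
  calc ∑ i, (K : ENNReal)⁻¹ * candidateLaw A ε δ D.1 D.2 s i O
      ≤ ∑ i, (ENNReal.ofReal (Real.exp ε) *
          ((K : ENNReal)⁻¹ * candidateLaw A ε δ D'.1 D'.2 s i O)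
          + (K : ENNReal)⁻¹ * ENNReal.ofReal δ) := by
        refine Finset.sum_le_sum fun i _ => ?_
        refine (mul_le_mul_right (hcand i O hO) _).trans_eq ?_
        ring
    _ = _ := by
        rw [Finset.sum_add_distrib, ← Finset.mul_sum, Finset.sum_const, Finset.card_univ,
          Fintype.card_fin, nsmul_eq_mul, ← mul_assoc, hK1, one_mul]

end Draw

/-! ### Parameters of the algorithm -/

section Parameters

lemma findRoot_spec {δtot : ℝ} (hδ : 0 < δtot ∧ δtot ≤ 1) :
    0 < findRoot δtot ∧ findRoot δtot ≤ 1 ∧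
      findRoot δtot * (1 - Real.log (findRoot δtot)) = δtot := by
  have hcont : Continuous fun t : ℝ => t + Real.negMulLog t :=
    continuous_id.add Real.continuous_negMulLog
  have hS : {t : ℝ | 0 < t ∧ t ≤ 1 ∧ t * (1 - Real.log t) = δtot}
      = Set.Icc 0 1 ∩ (fun t : ℝ => t + Real.negMulLog t) ⁻¹' {δtot} := by
    ext t
    simp only [Set.mem_ofPred_eq, Set.mem_inter_iff, Set.mem_Icc, Set.mem_preimage,
      Set.mem_singleton_iff]
    have e : t + Real.negMulLog t = t * (1 - Real.log t) := by rw [Real.negMulLog]; ring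
    rw [e]
    constructor
    · rintro ⟨h1, h2, h3⟩
      exact ⟨⟨h1.le, h2⟩, h3⟩
    · rintro ⟨⟨h1, h2⟩, h3⟩
      refine ⟨h1.lt_of_ne' ?_, h2, h3⟩
      rintro rfl
      simp at h3
      linarith [hδ.1]
  have hne : (Set.Icc (0 : ℝ) 1 ∩ (fun t : ℝ => t + Real.negMulLog t) ⁻¹' {δtot}).Nonempty := by
    obtain ⟨t, ht, hte⟩ := intermediate_value_Icc zero_le_one hcont.continuousOn
      (show δtot ∈ Set.Icc _ _ by simpa using ⟨hδ.1.le, hδ.2⟩)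
    exact ⟨t, ht, hte⟩
  have hmem := (isCompact_Icc.inter_right (isClosed_singleton.preimage hcont)).sInf_mem hne
  rw [← hS] at hmem
  exact hmem

variable {δtot γ : ℝ}

lemma sqrt_two_mul_candDelta (hδ : 0 < δtot ∧ δtot ≤ 1) (hγ : 0 < γ) :
    Real.sqrt (2 * candDelta δtot γ) = γ * findRoot δtot := by
  have ht := (findRoot_spec hδ).1
  rw [show 2 * candDelta δtot γ = (γ * findRoot δtot) ^ 2 by rw [candDelta]; ring,
    Real.sqrt_sq (by positivity)]

lemma stopDelta_eq_findRoot (hδ : 0 < δtot ∧ δtot ≤ 1) (hγ : 0 < γ) :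
    stopDelta δtot γ = findRoot δtot := by
  rw [stopDelta, sqrt_two_mul_candDelta hδ hγ, mul_div_cancel_left₀ _ hγ.ne']

/-- The failure masses of the draws and of the cap fit into `√(2 δ) T + δ₂`. Rounding `T` down to
`N` raises the mass `(1 - γ) ^ N` of the cap by a factor at most `e ^ u` with `u = γ (T - N)`; the
term `u` of `e ^ u` is paid for by `√(2 δ) (T - N)`, the rest by `√(2 δ) - δ` per draw. -/
lemma failure_mass_le {t γ T : ℝ} {N : ℕ} (hγ : 0 < γ ∧ γ ≤ 1) (ht : 0 < t)
    (hT : t = Real.exp (-(γ * T))) (hN : 1 ≤ N) (hNT : N ≤ T) (hTN : T < N + 1) :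
    γ ^ 2 * t ^ 2 / 2 * N + (1 - γ) ^ N ≤ γ * t * T + t := by
  obtain ⟨hγ0, hγ1⟩ := hγ
  set u := γ * (T - N) with hu
  have hN1 : (1 : ℝ) ≤ N := by exact_mod_cast hN
  have hu0 : 0 ≤ u := mul_nonneg hγ0.le (by linarith)
  have huγ : u ≤ γ := by
    calc u ≤ γ * 1 := by rw [hu]; gcongr; linarith
      _ = γ := mul_one γ
  have hpow : (1 - γ) ^ N ≤ t * Real.exp u := by
    calc (1 - γ) ^ N ≤ Real.exp (-γ) ^ N :=
          pow_le_pow_left₀ (by linarith) (by linarith [Real.add_one_le_exp (-γ)]) N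
      _ = t * Real.exp u := by
          rw [hT, ← Real.exp_nat_mul, ← Real.exp_add, hu]
          congr 1
          ring
  have hexp : Real.exp u ≤ 1 + u + 3 / 4 * u ^ 2 := by
    have := Real.exp_bound' hu0 (huγ.trans hγ1) (n := 2) two_pos
    norm_num [Finset.sum_range_succ, Nat.factorial] at this
    linarith
  have htγ : γ * t ≤ 1 / 2 := by
    have h1 : t ≤ Real.exp (-γ) := by
      rw [hT]
      refine Real.exp_le_exp.mpr (neg_le_neg (le_mul_of_one_le_right hγ0.le (hN1.trans hNT)))
    have h2 : t * (1 + γ) ≤ 1 := by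
      calc t * (1 + γ) ≤ Real.exp (-γ) * Real.exp γ := by
            gcongr
            linarith [Real.add_one_le_exp γ]
        _ = 1 := by rw [← Real.exp_add]; simp
    nlinarith
  have hu2 : u ^ 2 ≤ γ * N := by
    calc u ^ 2 ≤ γ ^ 2 := by gcongr
      _ ≤ γ * 1 := by nlinarith
      _ ≤ γ * N := by gcongr
  have hsmall : γ ^ 2 * t / 2 * N + 3 / 4 * u ^ 2 ≤ γ * N := by
    have : γ ^ 2 * t / 2 * N ≤ γ * N * (1 / 4) := by
      have := mul_le_mul_of_nonneg_left htγ (show 0 ≤ γ * N by positivity)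
      linarith
    linarith
  have hT' : γ * T = γ * N + u := by rw [hu]; ring
  calc γ ^ 2 * t ^ 2 / 2 * N + (1 - γ) ^ N
      ≤ γ ^ 2 * t ^ 2 / 2 * N + t * (1 + u + 3 / 4 * u ^ 2) := by
        gcongr
        exact hpow.trans (by gcongr)
    _ = t * (γ ^ 2 * t / 2 * N + 3 / 4 * u ^ 2) + t * (1 + u) := by ring
    _ ≤ t * (γ * N) + t * (1 + u) := by gcongr
    _ = t * (γ * T) + t := by rw [hT']; ring
    _ = γ * t * T + t := by ring

end Parameters

end DPGP

end

theorem theorem4 {p d K : ℕ} (n₁ n₂ : ℕ) (hK : 0 < K) (Ry : ℝ) (hRy : 0 < Ry)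
    (A : DPGP.Setup p d K)
    (hnoise : ∀ i, 0 < (A.cand i).noise)
    (hbound : ∀ i, DPGP.IsKernelBound (A.cand i).kernel A.Z (A.cand i).kernelBound)
    (hratio : 0 < A.ratio)
    (hreg : 0 < A.regFail ∧ A.regFail < 1)
    (hmean : 0 < A.meanFail ∧ A.meanFail < 1)
    (εtot δtot γ : ℝ) (hδ : 0 < δtot ∧ δtot ≤ 1) (hγ : 0 < γ ∧ γ ≤ 1)
    (hε : 0 < DPGP.candEps εtot δtot γ) :
    DPGP.IsDP DPGP.CombinedNeighbour
      (fun D : (Fin n₁ → DPGP.Entry p Ry) × (Fin n₂ → DPGP.Entry p Ry) =>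
        DPGP.learnHyperparameters A εtot δtot γ D) εtot δtot ∧
    εtot = 3 * DPGP.candEps εtot δtot γ + 3 * Real.sqrt (2 * DPGP.candDelta δtot γ) ∧
    δtot = Real.sqrt (2 * DPGP.candDelta δtot γ) * DPGP.maxDraws δtot γ
      + DPGP.stopDelta δtot γ := by
  open DPGP in
  obtain ⟨ht0, ht1, htδ⟩ := findRoot_spec hδ
  have hsqrt := sqrt_two_mul_candDelta hδ hγ.1
  have hδ₂ := stopDelta_eq_findRoot hδ hγ.1
  have hT : γ * maxDraws δtot γ = -Real.log (findRoot δtot) := by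
    rw [maxDraws, hδ₂, one_div (findRoot δtot), Real.log_inv, ← mul_assoc,
      mul_one_div_cancel hγ.1.ne', one_mul]
  have hεeq : εtot = 3 * candEps εtot δtot γ + 3 * Real.sqrt (2 * candDelta δtot γ) := by
    rw [candEps]; ring
  have hδeq : δtot = Real.sqrt (2 * candDelta δtot γ) * maxDraws δtot γ + stopDelta δtot γ := by
    rw [hsqrt, hδ₂, mul_right_comm, hT]
    linarith
  refine ⟨⟨fun D => ?_, fun D D' hD O hO => ?_⟩, hεeq, hδeq⟩
  · show MeasureTheory.IsProbabilityMeasure (loop _ _ _ _ _ _ _ _)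
    rw [loop_eq_stopLoop]
    have := isProbabilityMeasure_iteration hK A (candEps εtot δtot γ) (candDelta δtot γ) D.1 D.2
      (Sum.inl ())
    exact isProbabilityMeasure_stopLoop measurable_value
      (by rw [← ENNReal.ofReal_add hγ.1.le (by linarith [hγ.2])]; simp) _ _
  · set ε := candEps εtot δtot γ with hεdef
    set t := findRoot δtot with htdef
    have hδc : candDelta δtot γ = γ ^ 2 * t ^ 2 / 2 := rfl
    set δ := candDelta δtot γ with hδdef
    rw [hsqrt] at hεeq hδeq
    rw [hδ₂] at hδeq
    have hγt : γ * t ≤ γ := mul_le_of_le_one_right hγ.1.le ht1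
    have hγt0 : 0 < γ * t := mul_pos hγ.1 ht0
    have hδ01 : 0 < δ ∧ δ < 1 := by
      rw [hδc, ← mul_pow]
      exact ⟨by positivity, by nlinarith [hγ.2]⟩
    have hεtot : 0 ≤ εtot := by rw [hεeq]; positivity
    show loop A ε δ γ D.1 D.2 _ _ O ≤ _ * loop A ε δ γ D'.1 D'.2 _ _ O + _
    set N := ⌊maxDraws δtot γ⌋₊ with hN
    have hD' : CombinedNeighbour D' D := by
      rcases hD with ⟨⟨j, hj⟩, h⟩ | ⟨h, ⟨j, hj⟩⟩
      · exact Or.inl ⟨⟨j, fun i hi => (hj i hi).symm⟩, h.symm⟩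
      · exact Or.inr ⟨h.symm, ⟨j, fun i hi => (hj i hi).symm⟩⟩
    have hp := isProbabilityMeasure_iteration hK A ε δ D.1 D.2 (Sum.inl ())
    have hp' := isProbabilityMeasure_iteration hK A ε δ D'.1 D'.2 (Sum.inl ())
    rcases Nat.eq_zero_or_pos N with hN0 | hNpos
    · -- without any draw, the output does not depend on the data
      rw [hN0, loop, loop]
      exact (le_mul_of_one_le_left' (ENNReal.one_le_ofReal.mpr (Real.one_le_exp hεtot))).trans
        le_self_add
    · have hclose := close_stopLoop (g := ENNReal.ofReal γ) (g' := ENNReal.ofReal (1 - γ))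
        (E' := ENNReal.ofReal (Real.exp (ε + γ * t))) measurable_value value_le_init_iff
        (close_iteration hK hRy hbound hratio hmean hε hδ01 hD (Sum.inl ()))
        (close_iteration hK hRy hbound hratio hmean hε hδ01 hD' (Sum.inl ()))
        (by rw [← ENNReal.ofReal_add hγ.1.le (by linarith [hγ.2])]; simp)
        (by simpa using hγ.1)
        (ENNReal.one_le_ofReal.mpr (Real.one_le_exp (by positivity)))
        (ENNReal.ofReal_le_ofReal (Real.exp_le_exp.mpr (by linarith)))
        (by
          rw [← ENNReal.ofReal_mul (by linarith [hγ.2]),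
            ← ENNReal.ofReal_add hγ.1.le (mul_nonneg (by linarith [hγ.2]) hδ01.1.le),
            ← ENNReal.ofReal_mul (Real.exp_pos _).le]
          refine ENNReal.ofReal_le_ofReal ?_
          have h1 : (1 + γ * t) * γ ≤ Real.exp (ε + γ * t) * γ := by
            have := Real.add_one_le_exp (ε + γ * t)
            exact mul_le_mul_of_nonneg_right (by linarith) hγ.1.le
          have h2 : (1 - γ) * δ ≤ 1 * δ :=
            mul_le_mul_of_nonneg_right (by linarith [hγ.1]) hδ01.1.le
          have h3 : δ ≤ γ * t * γ := by rw [hδc]; nlinarith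
          linarith)
        N
      rw [loop_eq_stopLoop, loop_eq_stopLoop]
      refine (hclose.mono ?_ ?_) O hO
      · rw [← ENNReal.ofReal_mul (Real.exp_pos _).le, ← ENNReal.ofReal_mul (Real.exp_pos _).le,
          ← Real.exp_add, ← Real.exp_add]
        exact ENNReal.ofReal_le_ofReal (Real.exp_le_exp.mpr (by linarith))
      · rw [← ENNReal.ofReal_natCast, ← ENNReal.ofReal_mul hδ01.1.le,
          ← ENNReal.ofReal_pow (by linarith [hγ.2]),
          ← ENNReal.ofReal_add (mul_nonneg hδ01.1.le N.cast_nonneg)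
            (pow_nonneg (by linarith [hγ.2]) N)]
        refine ENNReal.ofReal_le_ofReal ?_
        have hT0 : 0 ≤ maxDraws δtot γ := (Nat.pos_of_floor_pos hNpos).le
        rw [hδeq, hδc]
        exact failure_mass_le hγ ht0 (by rw [hT, neg_neg, Real.exp_log ht0]) hNpos
          (Nat.floor_le hT0) (Nat.lt_floor_add_one _)
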